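/- **Setting.** Let $V$ be a unital $*$-algebra over $\mathbb C$ (local observables), with a state $\langle\cdot\rangle$ (a normalised, positive, Hermitian linear functional) and two commuting one-parameter groups of $*$-automorphisms, space translations $\iota_x$ and time translations $\tau_t$ ($x,t\in\mathbb R$), leaving the state invariant. Write $a(x,t)=\iota_x\tau_t a$ and $a(x)=a(x,0)$, and $\langle\cdots\rangle^{\rm c}$ for connected correlation functions (joint cumulants). Multi-point functions $\langle a_1(x_1,t_1)\cdots a_4(x_4,t_4)\rangle$ are assumed jointly continuous, and for all $a,b\in V$ there is $r>1$ with $\langle a(x)^\dagger b\rangle^{\rm c}=O((1+|x|)^{-r})$. $\mathcal H'$ is the Hilbert space obtained from $V$ with the semi-inner product $\langle a,b\rangle_{\mathcal H'}=\int dx\,\langle a(x)^\dagger b\rangle^{\rm c}$ by dividing out null vectors and completing. $\tau_t$ acts on it by unitaries. $\mathcal H_{\rm bal}=\bigcap_t\ker(\tau_t-1)\subset\mathcal H'$, and $\mathbb P_\tau$ is the orthogonal projection onto it. The lower Onsager matrix element of $a\in V$ is $$\mathcal L^-_{a,a}=\liminf_{T\to\infty}\frac1{2T}\Big\|\int_{-T}^T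 dt\,(1-\mathbb P_\tau)\tau_t a\Big\|^2_{\mathcal H'}\in[0,\infty].$$ A conservation law is a pair $q,j\in V$ with $\partial_t q(x,t)+\partial_x j(x,t)=0$, meaning that for all $b,c\in V$ the functions $\langle b\,q(x,t)\,c\rangle$ and $\langle b\,j(x,t)\,c\rangle$ are differentiable in $(x,t)$ and satisfy the equation. Normal modes are a family of conservation laws $(q_I,j_I)$ with $q_I^\dagger=q_I$ and $\langle q_I\rangle=0$, such that the classes of the $q_I$ form an orthonormal basis of $\mathcal H_{\rm bal}$, and numbers $v_I^{\rm eff}\in\mathbb R$ with $\mathbb P_\tau j_I=v_I^{\rm eff}q_I$ in $\mathcal H'$. Fix such a family. For $a\in V$ such that $\mathbb P_\tau a$ is represented by a local observable, fix a representative in $V$, so that $(1-\mathbb P_\tau)a$ denotes an element of $V$, and put $$\langle Q_IQ_J(1-\mathbb P_\tau)a\rangle^{\rm c}=\int dy\int dz\,\langle q_I(y)\,q_J(z)\,(1-\mathbb P_\tau)a\rangle^{\rm c}.$$ **Assumptions.** (i) *Lieb–Robinson-type clustering.* There are $v>0$ and $p>3$ such that for $n=2,3,4$ and all $a_1,\dots,a_n\in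 V$ there is a constant $C$ with $$|\langle a_1(x_1,t_1)\cdots a_n(x_n,t_n)\rangle^{\rm c}|\le C(1+d)^{-p}$$ for all $d\ge0$, whenever the $n$ points split into two nonempty groups such that any two points $i,j$ of different groups satisfy $|x_i-x_j|\ge v|t_i-t_j|$ and $|x_i-x_j|\ge d$. (ii) *Clustering around the ballistic trajectories, for $a$ and the pair $I_1=I$, $I_2=J$.* There is $\alpha\in(1/2,1)$ such that for every $\epsilon>0$ there are a finite set $E\subset\mathbb R$ and constants $C$, $T>0$ with $$|\langle b(y_1,0)\,c(y_2,0)\,(1-\mathbb P_\tau)a(x,t)\rangle^{\rm c}|\le C\sum_{\nu\in E}|t|^{-\nu}\,|x-y_i-v^{\rm eff}_{I_i}t|^{\nu-1/\alpha-1}$$ for all $b\in\{q_I,j_I\}$, $c\in\{q_J,j_J\}$, all $x,y_1,y_2$, all $|t|\ge T$ and each $i\in\{1,2\}$ with $|x-y_i-v^{\rm eff}_{I_i}t|\ge\epsilon|t|$ and $|x-y_i|\le v|t|$. **Theorem.** Assume (i), and let $a\in V$ and $I,J$ be such that $\mathbb P_\tau a$ has a local representative and (ii) holds. If $v_I^{\rm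 eff}\ne v_J^{\rm eff}$, then $$\mathcal L^-_{a,a}\ \ge\ \frac{\big|\langle Q_IQ_J(1-\mathbb P_\tau)a\rangle^{\rm c}\big|^2}{|v_I^{\rm eff}-v_J^{\rm eff}|}.$$ If $v_I^{\rm eff}=v_J^{\rm eff}$ (including $I=J$) and $\langle Q_IQ_J(1-\mathbb P_\tau)a\rangle^{\rm c}\neq0$, then $\mathcal L^-_{a,a}=\infty$. In particular, for a current $a=j_k$ of a conservation law $(q_k,j_k)$ satisfying these assumptions with some $I=J$, $\langle Q_I^2(1-\mathbb P_\tau)j_k\rangle^{\rm c}\ne0$ implies $\mathcal L^-_{kk}=\mathcal L^-_{j_k,j_k}=\infty$. -/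

import Mathlib

open MeasureTheory Filter Topology UniformSpace
open scoped ComplexConjugate InnerProductSpace ENNReal

noncomputable section

/-- A homogeneous, stationary one-dimensional many-body system: a unital `*`-algebra `A` of local
observables with a state, and commuting groups of space and time translations leaving the state
invariant. The algebra may be commutative (classical or stochastic systems) or not. -/
structure ManyBodySystem (A : Type*) [Ring A] [StarRing A] [Algebra ℂ A] [StarModule ℂ A] where
  /-- the state, `a ↦ ⟨a⟩` -/
  state : A →ₗ[ℂ] ℂ
  /-- space translations `ι_x` -/
  space : ℝ → A ≃⋆ₐ[ℂ] A
  /-- time translations `τ_t` -/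
  time : ℝ → A ≃⋆ₐ[ℂ] A
  state_one : state 1 = 1
  state_pos : ∀ a, 0 ≤ (state (star a * a)).re
  state_star : ∀ a, state (star a) = conj (state a)
  space_add : ∀ x y a, space (x + y) a = space x (space y a)
  time_add : ∀ s t a, time (s + t) a = time s (time t a)
  space_time_comm : ∀ x t a, space x (time t a) = time t (space x a)
  state_space : ∀ x a, state (space x a) = state a
  state_time : ∀ t a, state (time t a) = state a
  /-- multi-point functions (up to four points) are continuous in the space-time positions -/
  continuous_state : ∀ a b c d : A, Continuous fun p : (ℝ × ℝ) × (ℝ × ℝ) × (ℝ × ℝ) × (ℝ × ℝ) =>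
    state (space p.1.1 (time p.1.2 a) * space p.2.1.1 (time p.2.1.2 b) *
      space p.2.2.1.1 (time p.2.2.1.2 c) * space p.2.2.2.1 (time p.2.2.2.2 d))
  /-- projection at infinity for space translations (the thermodynamic space is `ℂ 1`): the
  connected two-point function decays in space faster than the inverse distance -/
  projection_at_infinity : ∀ a b : A, ∃ C r : ℝ, 1 < r ∧ ∀ x : ℝ,
    ‖state (star (space x a) * b) - conj (state a) * state b‖ ≤ C * (1 + |x|) ^ (-r)

namespace ManyBodySystem

variable {A : Type*} [Ring A] [StarRing A] [Algebra ℂ A] [StarModule ℂ A] (S : ManyBodySystem A)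

/-- The observable `a(x,t) = ι_x τ_t a`. -/
def evol (a : A) (x t : ℝ) : A := S.space x (S.time t a)

/-! ### Elementary consequences of the group laws -/

lemma space_zero (a : A) : S.space 0 a = a := by
  have h := S.space_add 0 0 a
  rw [add_zero] at h
  exact ((S.space 0).injective h).symm

lemma time_zero (a : A) : S.time 0 a = a := by
  have h := S.time_add 0 0 a
  rw [add_zero] at h
  exact ((S.time 0).injective h).symm

lemma state_star_mul (a b : A) : conj (S.state (star a * b)) = S.state (star b * a) := by
  rw [← S.state_star, star_mul, star_star]

/-! ### The Hilbert space of observables -/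

/-- The space of observables with the semi-inner product `⟨a, b⟩ = ⟨a† b⟩`. -/
@[nolint unusedArguments]
def PreH (_ : ManyBodySystem A) := A

instance : AddCommGroup S.PreH := inferInstanceAs (AddCommGroup A)
instance : Module ℂ S.PreH := inferInstanceAs (Module ℂ A)

/-- The identity map onto the type synonym. -/
def toPreH : A ≃ₗ[ℂ] S.PreH := LinearEquiv.refl ℂ A

/-- The semi-inner product `⟨a, b⟩ = ⟨a† b⟩`. -/
abbrev preHCore : PreInnerProductSpace.Core ℂ S.PreH where
  inner a b := S.state (star (S.toPreH.symm a) * S.toPreH.symm b)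
  conj_inner_symm a b := S.state_star_mul _ _
  re_inner_nonneg a := S.state_pos _
  add_left a b c := by rw [map_add, star_add, add_mul, map_add]
  smul_left a b r := by simp

instance : SeminormedAddCommGroup S.PreH :=
  InnerProductSpace.Core.toSeminormedAddCommGroup (c := S.preHCore)
instance : InnerProductSpace ℂ S.PreH := InnerProductSpace.ofCore S.preHCore

/-- The Hilbert space `H` of observables. -/
abbrev H := Completion S.PreH

/-! ### The form `⟨a, b⟩ = ∫ dx ⟨a(x)† b⟩ᶜ` of the hydrodynamic reduction by space translations -/

/-- The connected two-point function `⟨a(x)† b⟩ - ⟨a†⟩⟨b⟩`. -/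
def covKernel (a b : A) (x : ℝ) : ℂ :=
  S.state (star (S.space x a) * b) - conj (S.state a) * S.state b

/-- The space-integrated connected two-point function. -/
def covForm (a b : A) : ℂ := ∫ x : ℝ, S.covKernel a b x

lemma continuous_covKernel (a b : A) : Continuous (S.covKernel a b) := by
  have h := (S.continuous_state (star a) b 1 1).comp
    (by fun_prop : Continuous fun x : ℝ => ((x, (0 : ℝ)), ((0 : ℝ), (0 : ℝ)),
      ((0 : ℝ), (0 : ℝ)), ((0 : ℝ), (0 : ℝ))))
  refine Continuous.sub ?_ continuous_const
  simpa [Function.comp_def, S.space_zero, S.time_zero, map_star] using h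

lemma integrable_covKernel (a b : A) : Integrable (S.covKernel a b) := by
  obtain ⟨C, r, hr, h⟩ := S.projection_at_infinity a b
  have hi : Integrable fun x : ℝ => C * (1 + ‖x‖) ^ (-r) :=
    (integrable_one_add_norm (by simpa using hr)).const_mul C
  exact hi.mono' (S.continuous_covKernel a b).aestronglyMeasurable (ae_of_all _ h)

lemma covKernel_swap (a b : A) (x : ℝ) : conj (S.covKernel b a x) = S.covKernel a b (-x) := by
  unfold covKernel
  rw [map_sub, S.state_star_mul, map_mul (starRingEnd ℂ), Complex.conj_conj, mul_comm (S.state b)]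
  congr 1
  rw [← S.state_space (-x) (star a * S.space x b), map_mul (S.space (-x)), ← S.space_add,
    neg_add_cancel, S.space_zero, map_star (S.space (-x))]

lemma covForm_swap (a b : A) : conj (S.covForm b a) = S.covForm a b := by
  unfold covForm
  rw [← integral_conj]
  simp_rw [S.covKernel_swap a b]
  exact integral_neg_eq_self (S.covKernel a b) volume

lemma covForm_add_left (a b c : A) : S.covForm (a + b) c = S.covForm a c + S.covForm b c := by
  unfold covForm
  rw [← integral_add (S.integrable_covKernel a c) (S.integrable_covKernel b c)]
  congr 1
  ext x
  simp only [covKernel, map_add, star_add, add_mul]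
  ring

lemma covForm_smul_left (r : ℂ) (a b : A) : S.covForm (r • a) b = conj r * S.covForm a b := by
  unfold covForm
  rw [← integral_const_mul]
  congr 1
  ext x
  simp only [covKernel, map_smul, star_smul, smul_mul_assoc, smul_eq_mul, map_mul,
    Complex.star_def]
  ring

/-- The vectors `(1 - P_ι) ι_x a` in the Hilbert space `H`. -/
def orbit (a : A) (x : ℝ) : S.H := ((S.toPreH (S.space x a - S.state a • 1) : S.PreH) : S.H)

lemma inner_orbit (a : A) (x y : ℝ) :
    ⟪S.orbit a x, S.orbit a y⟫_ℂ = S.covKernel a a (x - y) := by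
  have h1 : ⟪S.orbit a x, S.orbit a y⟫_ℂ =
      S.state (star (S.space x a - S.state a • 1) * (S.space y a - S.state a • 1)) := by
    unfold orbit
    rw [Completion.inner_coe]
    rfl
  have h2 : S.state (star (S.space x a) * S.space y a) =
      S.state (star (S.space (x - y) a) * a) := by
    rw [← S.state_space y (star (S.space (x - y) a) * a), map_mul (S.space y),
      map_star (S.space y), ← S.space_add, add_sub_cancel]
  rw [h1]
  simp only [star_sub, sub_mul, mul_sub, map_sub, h2, covKernel, star_smul, star_one, smul_mul_assoc,
    mul_smul_comm, one_mul, mul_one, map_smul, S.state_one, S.state_star, S.state_space,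
    smul_eq_mul, Complex.star_def]
  ring

lemma continuous_orbit (a : A) : Continuous (S.orbit a) := by
  rw [continuous_iff_continuousAt]
  intro x
  rw [ContinuousAt, tendsto_iff_norm_sub_tendsto_zero]
  have key : ∀ y, ‖S.orbit a y - S.orbit a x‖ ^ 2 =
      2 * (S.covKernel a a 0).re - 2 * (S.covKernel a a (y - x)).re := by
    intro y
    rw [norm_sub_sq (𝕜 := ℂ), ← inner_self_eq_norm_sq (𝕜 := ℂ), ← inner_self_eq_norm_sq (𝕜 := ℂ),
      inner_orbit, inner_orbit, inner_orbit, sub_self, sub_self]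
    simp only [RCLike.re_to_complex]
    ring
  have hc : Tendsto (fun y => ‖S.orbit a y - S.orbit a x‖ ^ 2) (𝓝 x) (𝓝 0) := by
    simp_rw [key]
    have : Continuous fun y => 2 * (S.covKernel a a 0).re - 2 * (S.covKernel a a (y - x)).re :=
      continuous_const.sub (continuous_const.mul (Complex.continuous_re.comp
        ((S.continuous_covKernel a a).comp (continuous_id.sub continuous_const))))
    have h := this.tendsto x
    simpa using h
  have := hc.sqrt
  simpa using this

lemma covForm_self_nonneg (a : A) : 0 ≤ (S.covForm a a).re := by
  set f : ℝ → ℂ := S.covKernel a a with hf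
  have hfc : Continuous f := S.continuous_covKernel a a
  have hfi : Integrable f := S.integrable_covKernel a a
  have hgi : ∀ u v : ℝ, IntervalIntegrable (S.orbit a) volume u v := fun u v =>
    (S.continuous_orbit a).intervalIntegrable u v
  have hdouble : ∀ T : ℝ, 0 ≤ T →
      0 ≤ (∫ r in (0 : ℝ)..1, ∫ u in (-(r * T))..((1 - r) * T), f u).re := by
    intro T hT
    rcases hT.eq_or_lt with rfl | hT
    · simp
    have h1 : ((‖∫ s in (0 : ℝ)..T, S.orbit a s‖ ^ 2 : ℝ) : ℂ) =
        ∫ t in (0 : ℝ)..T, ∫ s in (0 : ℝ)..T, f (s - t) := by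
      have h2 : ∀ t, ⟪∫ s in (0 : ℝ)..T, S.orbit a s, S.orbit a t⟫_ℂ =
          ∫ s in (0 : ℝ)..T, f (s - t) := by
        intro t
        rw [← inner_conj_symm, intervalIntegral.integral_of_le hT.le,
          ← integral_inner ((intervalIntegrable_iff_integrableOn_Ioc_of_le hT.le).1 (hgi 0 T)),
          ← integral_conj, intervalIntegral.integral_of_le hT.le]
        simp_rw [inner_conj_symm, S.inner_orbit, hf]
      have h3 := inner_self_eq_norm_sq_to_K (𝕜 := ℂ) (∫ s in (0 : ℝ)..T, S.orbit a s)
      push_cast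
      rw [← Complex.coe_algebraMap, ← h3]
      simp_rw [← h2]
      rw [intervalIntegral.integral_of_le hT.le, intervalIntegral.integral_of_le hT.le,
        integral_inner (𝕜 := ℂ)
          ((intervalIntegrable_iff_integrableOn_Ioc_of_le hT.le).1 (hgi 0 T))]
    have h4 : (∫ t in (0 : ℝ)..T, ∫ s in (0 : ℝ)..T, f (s - t)) =
        (T : ℂ) * ∫ r in (0 : ℝ)..1, ∫ u in (-(r * T))..((1 - r) * T), f u := by
      have h5 := intervalIntegral.smul_integral_comp_mul_right (a := 0) (b := 1)
        (fun t => ∫ s in (0 : ℝ)..T, f (s - t)) T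
      rw [zero_mul, one_mul] at h5
      rw [← h5, Complex.real_smul]
      congr 1
      refine intervalIntegral.integral_congr fun r _ => ?_
      simp only [intervalIntegral.integral_comp_sub_right, zero_sub]
      congr 1
      ring
    have h6 : ‖∫ s in (0 : ℝ)..T, S.orbit a s‖ ^ 2 =
        T * (∫ r in (0 : ℝ)..1, ∫ u in (-(r * T))..((1 - r) * T), f u).re := by
      have := congrArg Complex.re (h1.trans h4)
      rwa [Complex.ofReal_re, Complex.re_ofReal_mul] at this
    have h7 : 0 ≤ T * (∫ r in (0 : ℝ)..1, ∫ u in (-(r * T))..((1 - r) * T), f u).re := by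
      rw [← h6]; positivity
    exact nonneg_of_mul_nonneg_right h7 hT
  have hlim : Tendsto (fun T : ℝ => ∫ r in (0 : ℝ)..1, ∫ u in (-(r * T))..((1 - r) * T), f u)
      atTop (𝓝 (∫ _r in (0 : ℝ)..1, ∫ u, f u)) := by
    refine intervalIntegral.tendsto_integral_filter_of_dominated_convergence
      (fun _ => ∫ u, ‖f u‖) ?_ ?_ ?_ ?_
    · refine Eventually.of_forall fun T => Continuous.aestronglyMeasurable ?_
      have hF : Continuous fun y => ∫ u in (0 : ℝ)..y, f u :=
        intervalIntegral.continuous_primitive (fun u v => hfc.intervalIntegrable u v) 0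
      have : (fun r : ℝ => ∫ u in (-(r * T))..((1 - r) * T), f u) = fun r =>
          (∫ u in (0 : ℝ)..((1 - r) * T), f u) - ∫ u in (0 : ℝ)..(-(r * T)), f u := by
        ext r
        rw [intervalIntegral.integral_interval_sub_left] <;> exact hfc.intervalIntegrable _ _
      rw [this]
      fun_prop
    · refine Eventually.of_forall fun T => ae_of_all _ fun r _ => ?_
      refine (intervalIntegral.norm_integral_le_integral_norm_uIoc).trans ?_
      exact setIntegral_le_integral hfi.norm (ae_of_all _ fun _ => norm_nonneg _)
    · exact intervalIntegrable_const
    · have h1 : ∀ᵐ r : ℝ, r ≠ 1 := by simp [ae_iff]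
      filter_upwards [h1] with r hr1 hr
      rw [Set.uIoc_of_le zero_le_one] at hr
      have hr2 : r < 1 := lt_of_le_of_ne hr.2 hr1
      refine intervalIntegral_tendsto_integral hfi ?_ ?_
      · exact tendsto_neg_atTop_atBot.comp (tendsto_id.const_mul_atTop hr.1)
      · exact tendsto_id.const_mul_atTop (by linarith)
  have hlim' : Tendsto (fun T : ℝ =>
      (∫ r in (0 : ℝ)..1, ∫ u in (-(r * T))..((1 - r) * T), f u).re) atTop
      (𝓝 (S.covForm a a).re) := by
    have := (Complex.continuous_re.tendsto _).comp hlim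
    simpa [covForm, hf, Function.comp_def] using this
  exact ge_of_tendsto hlim' ((eventually_ge_atTop 0).mono hdouble)

/-! ### The Hilbert space `H'` -/

/-- The space of observables with the semi-inner product `⟨a, b⟩ = ∫ dx ⟨a(x)† b⟩ᶜ`. -/
@[nolint unusedArguments]
def PreH' (_ : ManyBodySystem A) := A

instance : AddCommGroup S.PreH' := inferInstanceAs (AddCommGroup A)
instance : Module ℂ S.PreH' := inferInstanceAs (Module ℂ A)

/-- The identity map onto the type synonym. -/
def toPreH' : A ≃ₗ[ℂ] S.PreH' := LinearEquiv.refl ℂ A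

/-- The semi-inner product `⟨a, b⟩ = ∫ dx ⟨a(x)† b⟩ᶜ`. -/
abbrev preHCore' : PreInnerProductSpace.Core ℂ S.PreH' where
  inner a b := S.covForm (S.toPreH'.symm a) (S.toPreH'.symm b)
  conj_inner_symm _ _ := S.covForm_swap _ _
  re_inner_nonneg _ := S.covForm_self_nonneg _
  add_left _ _ _ := S.covForm_add_left _ _ _
  smul_left _ _ _ := S.covForm_smul_left _ _ _

instance : SeminormedAddCommGroup S.PreH' :=
  InnerProductSpace.Core.toSeminormedAddCommGroup (c := S.preHCore')
instance : InnerProductSpace ℂ S.PreH' := InnerProductSpace.ofCore S.preHCore'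

/-- The first-order hydrodynamic Hilbert space `H'`: observables modulo null vectors of
`∫ dx ⟨a(x)† b⟩ᶜ`, completed. -/
abbrev H' := Completion S.PreH'

/-- The class of an observable in `H'`. -/
def cls : A →ₗ[ℂ] S.H' := (Completion.toComplₗᵢ.toLinearMap).comp S.toPreH'.toLinearMap

lemma inner_cls (a b : A) : ⟪S.cls a, S.cls b⟫_ℂ = S.covForm a b :=
  Completion.inner_coe _ _

lemma denseRange_cls : DenseRange S.cls :=
  Completion.denseRange_coe.comp S.toPreH'.surjective.denseRange (Completion.continuous_coe _)

lemma covForm_time (t : ℝ) (a b : A) : S.covForm (S.time t a) (S.time t b) = S.covForm a b := by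
  unfold covForm covKernel
  congr 1
  ext x
  rw [S.space_time_comm, ← map_star, ← map_mul, S.state_time, S.state_time, S.state_time]

/-- Time translation as an isometry of the pre-Hilbert space. -/
def timePre (t : ℝ) : S.PreH' →ₗᵢ[ℂ] S.PreH' where
  toFun a := S.toPreH' (S.time t (S.toPreH'.symm a))
  map_add' a b := by simp
  map_smul' r a := by simp
  norm_map' a := by
    rw [@norm_eq_sqrt_re_inner ℂ, @norm_eq_sqrt_re_inner ℂ]
    exact congrArg (fun z : ℂ => √z.re) (S.covForm_time t _ _)

/-- The time translation `τ_t` on `H'`. -/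
def timeH (t : ℝ) : S.H' →L[ℂ] S.H' := (S.timePre t).toContinuousLinearMap.completion

lemma timeH_cls (t : ℝ) (a : A) : S.timeH t (S.cls a) = S.cls (S.time t a) :=
  (S.timePre t).toContinuousLinearMap.completion_apply_coe (S.toPreH' a)

/-- The ballistic space: the closed subspace of `H'` of vectors invariant under all `τ_t`. -/
def ballistic : Submodule ℂ S.H' := ⨅ t : ℝ, (S.timeH t - ContinuousLinearMap.id ℂ S.H').ker

lemma isClosed_ballistic : IsClosed (S.ballistic : Set S.H') := by
  rw [ballistic, Submodule.coe_iInf]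
  exact isClosed_iInter fun t => (S.timeH t - ContinuousLinearMap.id ℂ S.H').isClosed_ker

instance : CompleteSpace S.ballistic := S.isClosed_ballistic.completeSpace_coe

/-- The orthogonal projection `P_τ` of `H'` onto the ballistic space. -/
def projBal : S.H' →L[ℂ] S.H' := S.ballistic.starProjection

/-- The lower norm `‖ψ‖⁻` of the second-order hydrodynamic space `H''`. -/
def lowerNorm (ψ : S.H') : ℝ≥0∞ :=
  (liminf (fun T : ℝ => ENNReal.ofReal
    (1 / (2 * T) * ‖∫ t in (-T)..T, (S.timeH t ψ - S.projBal (S.timeH t ψ))‖ ^ 2)) atTop)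
    ^ (1 / 2 : ℝ)

/-- The lower diagonal Onsager matrix element `L⁻_{a,a}`. -/
def onsagerLower (a : A) : ℝ≥0∞ := S.lowerNorm (S.cls a) ^ 2

/-! ### Connected correlation functions -/

/-- `⟨a b⟩ᶜ` -/
def conn₂ (a b : A) : ℂ := S.state (a * b) - S.state a * S.state b

/-- `⟨a b c⟩ᶜ` -/
def conn₃ (a b c : A) : ℂ :=
  S.state (a * b * c)
    - S.state a * S.conn₂ b c - S.state b * S.conn₂ a c - S.state c * S.conn₂ a b
    - S.state a * S.state b * S.state c

/-- `⟨a b c d⟩ᶜ` -/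
def conn₄ (a b c d : A) : ℂ :=
  S.state (a * b * c * d)
    - S.state a * S.conn₃ b c d - S.state b * S.conn₃ a c d
    - S.state c * S.conn₃ a b d - S.state d * S.conn₃ a b c
    - S.conn₂ a b * S.conn₂ c d - S.conn₂ a c * S.conn₂ b d - S.conn₂ a d * S.conn₂ b c
    - S.conn₂ a b * S.state c * S.state d - S.conn₂ a c * S.state b * S.state d
    - S.conn₂ a d * S.state b * S.state c - S.conn₂ b c * S.state a * S.state d
    - S.conn₂ b d * S.state a * S.state c - S.conn₂ c d * S.state a * S.state b
    - S.state a * S.state b * S.state c * S.state d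

/-- The space-time points `X i = (x_i, t_i)` split into two nonempty groups such that any two
points of different groups are at distance at least `d` and outside each other's cone
`|x| < v |t|`. -/
def Separated {n : ℕ} (v d : ℝ) (X : Fin n → ℝ × ℝ) : Prop :=
  ∃ s : Finset (Fin n), s.Nonempty ∧ sᶜ.Nonempty ∧ ∀ i ∈ s, ∀ j ∈ sᶜ,
    v * |(X i).2 - (X j).2| ≤ |(X i).1 - (X j).1| ∧ d ≤ |(X i).1 - (X j).1|

/-- Lieb-Robinson-type clustering with velocity `v` and power `p` of the connected two-, three- and
four-point functions, uniformly in the positions. -/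
structure Clusters (v p : ℝ) : Prop where
  two : ∀ a : Fin 2 → A, ∃ C : ℝ, ∀ (X : Fin 2 → ℝ × ℝ) (d : ℝ), 0 ≤ d → Separated v d X →
    ‖S.conn₂ (S.evol (a 0) (X 0).1 (X 0).2) (S.evol (a 1) (X 1).1 (X 1).2)‖ ≤ C * (1 + d) ^ (-p)
  three : ∀ a : Fin 3 → A, ∃ C : ℝ, ∀ (X : Fin 3 → ℝ × ℝ) (d : ℝ), 0 ≤ d → Separated v d X →
    ‖S.conn₃ (S.evol (a 0) (X 0).1 (X 0).2) (S.evol (a 1) (X 1).1 (X 1).2)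
      (S.evol (a 2) (X 2).1 (X 2).2)‖ ≤ C * (1 + d) ^ (-p)
  four : ∀ a : Fin 4 → A, ∃ C : ℝ, ∀ (X : Fin 4 → ℝ × ℝ) (d : ℝ), 0 ≤ d → Separated v d X →
    ‖S.conn₄ (S.evol (a 0) (X 0).1 (X 0).2) (S.evol (a 1) (X 1).1 (X 1).2)
      (S.evol (a 2) (X 2).1 (X 2).2) (S.evol (a 3) (X 3).1 (X 3).2)‖ ≤ C * (1 + d) ^ (-p)

/-- The coupling `⟨Q Q' a⟩ᶜ = ∫∫ dy dz ⟨q(y) q'(z) a⟩ᶜ` of the total charges of `q`, `q'`. -/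
def coupling (q q' a : A) : ℂ :=
  ∫ y : ℝ × ℝ, S.conn₃ (S.evol q y.1 0) (S.evol q' y.2 0) a

/-! ### Conserved densities and normal modes -/

/-- The conservation law `∂_t q(x,t) + ∂_x j(x,t) = 0`, inside all averages `⟨b · c⟩`. -/
structure ConservationLaw (q j : A) : Prop where
  differentiable_density : ∀ b c : A,
    Differentiable ℝ fun p : ℝ × ℝ => S.state (b * S.evol q p.1 p.2 * c)
  differentiable_current : ∀ b c : A,
    Differentiable ℝ fun p : ℝ × ℝ => S.state (b * S.evol j p.1 p.2 * c)
  continuity_equation : ∀ (b c : A) (x t : ℝ),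
    deriv (fun t' => S.state (b * S.evol q x t' * c)) t +
      deriv (fun x' => S.state (b * S.evol j x' t * c)) x = 0

/-- `a₀` is a local observable representing the projection `P_τ a` of `a` onto the conserved
densities. -/
def IsBallisticPart (a a₀ : A) : Prop := S.cls a₀ = S.projBal (S.cls a)

/-- Normal modes: local, self-adjoint, centred conserved densities `q_I`, with local currents `j_I`,
whose classes are an orthonormal basis of the ballistic space in which the flux Jacobian is
diagonal, with eigenvalues the effective velocities `v_I`. -/
structure NormalModes (M : Type*) where
  q : M → A
  j : M → A
  veff : M → ℝ
  star_q : ∀ I, star (q I) = q I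
  state_q : ∀ I, S.state (q I) = 0
  conservation : ∀ I, S.ConservationLaw (q I) (j I)
  orthonormal : Orthonormal ℂ fun I => S.cls (q I)
  complete : (Submodule.span ℂ (Set.range fun I => S.cls (q I))).topologicalClosure = S.ballistic
  flux : ∀ I, S.projBal (S.cls (j I)) = (veff I : ℂ) • S.cls (q I)

variable {S} in
/-- Clustering of the three-point functions `⟨b_I(y₁,0) c_J(y₂,0) a(x,t)⟩ᶜ`, with `b_I, c_J` densities
or currents of the normal modes `I, J`, around the ballistic trajectories `x - y_i = v_i t`: as soon
as `(x,t)` is off one of the two trajectories, `|x - y_i - v_i t| ≥ ε |t|`, and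
inside the cone `|x - y_i| ≤ v |t|`, the function is bounded at large times by a finite sum
of terms `|t|^{-ν} |x - y_i - v_i t|^{ν - 1/α - 1}`. -/
def NormalModes.HydroClusters {M : Type*} (N : S.NormalModes M) (v : ℝ) (a : A) (I J : M) : Prop :=
  ∃ α ∈ Set.Ioo (1 / 2 : ℝ) 1, ∀ ε > 0, ∃ (E : Finset ℝ) (C T : ℝ), 0 < T ∧
    ∀ b ∈ ({N.q I, N.j I} : Set A), ∀ c ∈ ({N.q J, N.j J} : Set A), ∀ x y₁ y₂ t : ℝ, T ≤ |t| →
      (ε * |t| ≤ |x - y₁ - N.veff I * t| → |x - y₁| ≤ v * |t| →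
        ‖S.conn₃ (S.evol b y₁ 0) (S.evol c y₂ 0) (S.evol a x t)‖ ≤
          C * ∑ ν ∈ E, |t| ^ (-ν) * |x - y₁ - N.veff I * t| ^ (ν - 1 / α - 1)) ∧
      (ε * |t| ≤ |x - y₂ - N.veff J * t| → |x - y₂| ≤ v * |t| →
        ‖S.conn₃ (S.evol b y₁ 0) (S.evol c y₂ 0) (S.evol a x t)‖ ≤
          C * ∑ ν ∈ E, |t| ^ (-ν) * |x - y₂ - N.veff J * t| ^ (ν - 1 / α - 1))

end ManyBodySystem

end

/-! The bound is Cauchy–Schwarz in `H'` against a quadratic test vector. Put b = (1 - P_τ)a and w_R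
= ∫_{-R}^{R} dy q_J(0) q_I(y), with R = V T and V = |v_I - v_J| + ε. Then (1/2T) ‖∫_{-T}^{T} τ_t b‖²
is at least |⟨w_R, ∫ τ_t b⟩|² / (2T ‖w_R‖²), and the numerator and denominator are controlled
separately.

Norm. The densities are centred, so the covariance of two quadratic observables is a connected
four-point function plus two Wick pairings. The four-point term decays integrably in y and y' (each
of its three variables gets the power p/3 > 1), so it contributes O(1). The pairings are functions
of y + y' and y - y'. Hence ‖w_R‖² / 2R tends to L, with L = 1 for I ≠ J and L = 2 for I = J, by
orthonormality (`Clusters.tendsto_inner_quadVec`).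

Overlap. Extended to all y, the overlap of the test vector with τ_t b is the integral of ⟨q_I(x+y)
q_J(x) b(0,t)⟩ᶜ over both charge positions. By the conservation laws it equals the coupling c for
every t (`Clusters.integral_conn₃_eq_coupling`). The discarded region |y| > V T lies in |y| ≥ V |t|
when |t| ≤ T. There the two charges are too far apart for both to sit on ballistic trajectories
through b, so the correlator decays with total power above 2: this pays for two space integrals and
leaves a negative power of |t|, whose time average vanishes
(`NormalModes.HydroClusters.exists_conn₃_le_mul`, `tendsto_average_rpow`).

Together these give |c|² / (L V) (`NormalModes.HydroClusters.le_onsagerLower`). As ε tends to 0, V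
tends to |v_I - v_J|: this is the stated bound for distinct velocities, and the bound diverges for
equal ones when c ≠ 0. -/

/-! ### Elementary estimates -/

/-- Points on the line with spread at least `m` split into two groups at distance at least `m / n`. -/
lemma exists_gap {n : ℕ} (hn : 2 ≤ n) (x : Fin n → ℝ) {m : ℝ} (hm : 0 ≤ m) {i j : Fin n}
    (h : m ≤ |x i - x j|) :
    ∃ s : Finset (Fin n), s.Nonempty ∧ sᶜ.Nonempty ∧ ∀ k ∈ s, ∀ l ∈ sᶜ, m / n ≤ |x k - x l| := by
  classical
  have hn0 : (0 : ℝ) < n := by exact_mod_cast (by omega : 0 < n)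
  rcases hm.eq_or_lt with rfl | hm
  · refine ⟨{⟨0, by omega⟩}, by simp, ⟨⟨1, by omega⟩, by simp [Fin.ext_iff]⟩, fun k _ l _ => ?_⟩
    rw [zero_div]; exact abs_nonneg _
  wlog hij : x i ≤ x j generalizing i j
  · exact this (by rwa [abs_sub_comm]) (le_of_not_ge hij)
  rw [abs_sub_comm, abs_of_nonneg (sub_nonneg.2 hij)] at h
  -- Pigeonhole: cut the stretch of length m to the right of x i into n open intervals. Either one
  -- contains no point and separates the groups, or choosing a point in each gives an injection of
  -- `Fin n` into itself, hence a surjection, although x i lies in none of the intervals.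
  by_cases hgap : ∃ c : Fin n, ∀ k, ¬ (x i + c * (m / n) < x k ∧ x k < x i + (c + 1) * (m / n))
  · obtain ⟨c, hc⟩ := hgap
    have hmn : 0 < m / n := by positivity
    have hcn : (c : ℝ) + 1 ≤ n := by exact_mod_cast c.2
    have hj : x i + c * (m / n) < x j := by
      have : ((c : ℝ) + 1) * (m / n) ≤ n * (m / n) := by gcongr
      rw [mul_div_cancel₀ _ hn0.ne'] at this
      linarith
    refine ⟨Finset.univ.filter fun k => x k ≤ x i + c * (m / n), ⟨i, ?_⟩, ⟨j, ?_⟩, ?_⟩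
    · simp only [Finset.mem_filter, Finset.mem_univ, true_and, le_add_iff_nonneg_right]
      positivity
    · simpa using hj
    · intro k hk l hl
      simp only [Finset.mem_filter, Finset.mem_univ, true_and, Finset.compl_filter, not_le]
        at hk hl
      have := hc l
      push Not at this
      have := this hl
      rw [abs_sub_comm]
      refine le_trans ?_ (le_abs_self _)
      linarith
  · push Not at hgap
    choose f hf1 hf2 using hgap
    have hmn : 0 < m / n := by positivity
    have hinj : Function.Injective f := by
      intro a b hab
      have h1 := hf1 a
      have h2 := hf2 a
      have h3 := hf1 b
      have h4 := hf2 b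
      rw [hab] at h1 h2
      have h5 : (a : ℝ) < b + 1 := by
        by_contra! h
        have : ((b : ℝ) + 1) * (m / n) ≤ a * (m / n) := by gcongr
        linarith
      have h6 : (b : ℝ) < a + 1 := by
        by_contra! h
        have : ((a : ℝ) + 1) * (m / n) ≤ b * (m / n) := by gcongr
        linarith
      have h7 : (a : ℕ) < b + 1 := by exact_mod_cast h5
      have h8 : (b : ℕ) < a + 1 := by exact_mod_cast h6
      exact Fin.ext (by omega)
    obtain ⟨c, hc⟩ := (Finite.surjective_of_injective hinj) i
    have := hf1 c
    rw [hc] at this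
    have : (0 : ℝ) ≤ c * (m / n) := by positivity
    linarith

lemma one_add_mul_rpow_neg_le {k m p : ℝ} (hk : 0 < k) (hk1 : k ≤ 1) (hm : 0 ≤ m) (hp : 0 ≤ p) :
    (1 + k * m) ^ (-p) ≤ k ^ (-p) * (1 + m) ^ (-p) := by
  rw [← Real.mul_rpow hk.le (by positivity)]
  exact Real.rpow_le_rpow_of_nonpos (by positivity) (by nlinarith) (by linarith)

lemma one_add_rpow_neg_add_le {a b m r s : ℝ} (ha : 0 ≤ a) (hb : 0 ≤ b) (ham : a ≤ m) (hbm : b ≤ m)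
    (hr : 0 ≤ r) (hs : 0 ≤ s) :
    (1 + m) ^ (-(r + s)) ≤ (1 + a) ^ (-r) * (1 + b) ^ (-s) := by
  have hm : 0 ≤ m := ha.trans ham
  rw [neg_add, Real.rpow_add (by positivity)]
  have h1 : (1 + m) ^ (-r) ≤ (1 + a) ^ (-r) :=
    Real.rpow_le_rpow_of_nonpos (by positivity) (by linarith) (by linarith)
  have h2 : (1 + m) ^ (-s) ≤ (1 + b) ^ (-s) :=
    Real.rpow_le_rpow_of_nonpos (by positivity) (by linarith) (by linarith)
  gcongr

lemma integrable_one_add_abs_rpow {r : ℝ} (hr : 1 < r) :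
    Integrable fun x : ℝ => (1 + |x|) ^ (-r) :=
  integrable_one_add_norm (E := ℝ) (μ := volume) (by simpa using hr)

/-- Decay outside a ball, uniform in a compact set of parameters, extends to all points. -/
lemma exists_decay_bound {K E : Type*} [TopologicalSpace K] [NormedAddCommGroup E] [ProperSpace E]
    {f : K → E → ℂ} (hf : Continuous (Function.uncurry f)) {s : Set K} (hs : IsCompact s)
    {C p M k : ℝ} (hp : 0 ≤ p) (hk : 0 < k) (hk1 : k ≤ 1)
    (h : ∀ κ ∈ s, ∀ x, M ≤ ‖x‖ → ‖f κ x‖ ≤ C * (1 + k * ‖x‖) ^ (-p)) :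
    ∃ C', 0 ≤ C' ∧ ∀ κ ∈ s, ∀ x, ‖f κ x‖ ≤ C' * (1 + ‖x‖) ^ (-p) := by
  obtain ⟨B, hB⟩ := (hs.prod (isCompact_closedBall (0 : E) M)).exists_bound_of_continuousOn
    hf.continuousOn
  refine ⟨|C| * k ^ (-p) + |B| * (1 + |M|) ^ p, by positivity, fun κ hκ x => ?_⟩
  rw [add_mul]
  have h0 : (0 : ℝ) < 1 + ‖x‖ := by positivity
  rcases le_total M ‖x‖ with hx | hx
  · have h1 : C * (1 + k * ‖x‖) ^ (-p) ≤ |C| * (k ^ (-p) * (1 + ‖x‖) ^ (-p)) := by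
      refine mul_le_mul (le_abs_self _) ?_ (by positivity) (abs_nonneg _)
      exact one_add_mul_rpow_neg_le hk hk1 (norm_nonneg _) hp
    have h2 : 0 ≤ |B| * (1 + |M|) ^ p * (1 + ‖x‖) ^ (-p) := by positivity
    linarith [h κ hκ x hx]
  · have h1 : ‖f κ x‖ ≤ |B| :=
      (hB (κ, x) ⟨hκ, by simpa using hx⟩).trans (le_abs_self _)
    have h2 : 0 ≤ |C| * k ^ (-p) * (1 + ‖x‖) ^ (-p) := by positivity
    have h3 : 1 ≤ (1 + |M|) ^ p * (1 + ‖x‖) ^ (-p) := by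
      rw [Real.rpow_neg h0.le, ← div_eq_mul_inv, one_le_div (by positivity)]
      exact Real.rpow_le_rpow h0.le (by linarith [le_abs_self M]) hp
    nlinarith [abs_nonneg B]

/-- Averages over a square of a function of the difference. -/
lemma tendsto_average_sub {f : ℝ → ℂ} (hfc : Continuous f) (hfi : Integrable f) :
    Tendsto (fun R : ℝ => ((2 * R : ℝ) : ℂ)⁻¹ *
      ∫ y in (-R)..R, ∫ y' in (-R)..R, f (y - y')) atTop (𝓝 (∫ u, f u)) := by
  have hF : Continuous fun y => ∫ u in (0 : ℝ)..y, f u :=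
    intervalIntegral.continuous_primitive (fun u v => hfc.intervalIntegrable u v) 0
  -- After the rescaling y = sR, the inner integral runs over a window that exhausts the line for
  -- every |s| < 1, so dominated convergence applies with the L¹ norm of f as bound.
  have hlim : Tendsto (fun R : ℝ => ∫ s in (-1 : ℝ)..1, ∫ u in (s * R - R)..(s * R + R), f u)
      atTop (𝓝 (∫ _s in (-1 : ℝ)..1, ∫ u, f u)) := by
    refine intervalIntegral.tendsto_integral_filter_of_dominated_convergence
      (fun _ => ∫ u, ‖f u‖) ?_ ?_ ?_ ?_
    · refine Eventually.of_forall fun T => Continuous.aestronglyMeasurable ?_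
      have : (fun s : ℝ => ∫ u in (s * T - T)..(s * T + T), f u) = fun s =>
          (∫ u in (0 : ℝ)..(s * T + T), f u) - ∫ u in (0 : ℝ)..(s * T - T), f u := by
        ext r
        rw [intervalIntegral.integral_interval_sub_left] <;> exact hfc.intervalIntegrable _ _
      rw [this]
      fun_prop
    · refine Eventually.of_forall fun T => ae_of_all _ fun r _ => ?_
      refine (intervalIntegral.norm_integral_le_integral_norm_uIoc).trans ?_
      exact setIntegral_le_integral hfi.norm (ae_of_all _ fun _ => norm_nonneg _)
    · exact intervalIntegrable_const
    -- At an endpoint the window fills only a half-line. The endpoint 1 is a null set; -1 is already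
    -- absent from the half-open interval.
    · have h1 : ∀ᵐ r : ℝ, r ≠ 1 := by simp [ae_iff]
      filter_upwards [h1] with r hr1 hr
      rw [Set.uIoc_of_le (by norm_num)] at hr
      have hr2 : r < 1 := lt_of_le_of_ne hr.2 hr1
      refine intervalIntegral_tendsto_integral hfi ?_ ?_
      · have : (fun T : ℝ => r * T - T) = fun T => (r - 1) * T := by ext; ring
        rw [this]
        exact tendsto_id.const_mul_atTop_of_neg (by linarith)
      · have : (fun T : ℝ => r * T + T) = fun T => (r + 1) * T := by ext; ring
        rw [this]
        exact tendsto_id.const_mul_atTop (by linarith [hr.1])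
  have h2 := hlim.const_mul (2 : ℂ)⁻¹
  have h3 : (2 : ℂ)⁻¹ * ∫ _s in (-1 : ℝ)..1, ∫ u, f u = ∫ u, f u := by
    rw [intervalIntegral.integral_const, Complex.real_smul]
    push_cast
    ring
  rw [h3] at h2
  refine h2.congr' ?_
  filter_upwards [eventually_gt_atTop 0] with R hR
  have h5 := intervalIntegral.smul_integral_comp_mul_right (a := -1) (b := 1)
    (fun y => ∫ y' in (-R)..R, f (y - y')) R
  rw [one_mul, neg_one_mul] at h5
  rw [← h5, Complex.real_smul, ← mul_assoc]
  have hR' : (R : ℂ) ≠ 0 := by exact_mod_cast hR.ne'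
  congr 1
  · push_cast
    field_simp
  · refine intervalIntegral.integral_congr fun s _ => ?_
    simp only [intervalIntegral.integral_comp_sub_left, sub_neg_eq_add]

/-- Averages of `(1 + |t|) ^ (-γ)` over growing symmetric intervals tend to zero. -/
lemma tendsto_average_rpow {γ : ℝ} (hγ : 0 < γ) :
    Tendsto (fun T : ℝ => (2 * T)⁻¹ * ∫ t in (-T)..T, (1 + |t|) ^ (-γ)) atTop (𝓝 0) := by
  -- Rescaling t = sT makes the integrand bounded by 1 and pointwise null for s ≠ 0, which treats
  -- all γ > 0 at once.
  have hlim : Tendsto (fun T : ℝ => ∫ s in (-1 : ℝ)..1, (1 + |s * T|) ^ (-γ))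
      atTop (𝓝 (∫ _s in (-1 : ℝ)..1, (0 : ℝ))) := by
    refine intervalIntegral.tendsto_integral_filter_of_dominated_convergence
      (fun _ => 1) ?_ ?_ intervalIntegrable_const ?_
    · refine Eventually.of_forall fun T => Continuous.aestronglyMeasurable ?_
      exact Continuous.rpow_const (by fun_prop) fun s => Or.inl (by positivity)
    · refine Eventually.of_forall fun T => ae_of_all _ fun r _ => ?_
      rw [Real.norm_of_nonneg (by positivity)]
      exact Real.rpow_le_one_of_one_le_of_nonpos (by linarith [abs_nonneg (r * T)]) (by linarith)
    · have h1 : ∀ᵐ r : ℝ, r ≠ 0 := by simp [ae_iff]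
      filter_upwards [h1] with r hr _
      refine (tendsto_rpow_neg_atTop hγ).comp (tendsto_atTop_add_const_left _ _ ?_)
      simp_rw [abs_mul]
      exact tendsto_abs_atTop_atTop.const_mul_atTop (by positivity)
  have h2 := hlim.const_mul (2 : ℝ)⁻¹
  rw [intervalIntegral.integral_zero, mul_zero] at h2
  refine h2.congr' ?_
  filter_upwards [eventually_gt_atTop 0] with R hR
  have h5 := intervalIntegral.smul_integral_comp_mul_right (a := -1) (b := 1)
    (fun t : ℝ => (1 + |t|) ^ (-γ)) R
  rw [one_mul, neg_one_mul] at h5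
  rw [← h5, smul_eq_mul, ← mul_assoc]
  congr 1
  field_simp

/-- A family of vectors with jointly continuous Gram kernel is continuous. -/
lemma continuous_of_continuous_inner {E K : Type*} [NormedAddCommGroup E] [InnerProductSpace ℂ E]
    [TopologicalSpace K] {F : K → E} (h : Continuous fun q : K × K => ⟪F q.1, F q.2⟫_ℂ) :
    Continuous F := by
  rw [continuous_iff_continuousAt]
  intro x
  rw [ContinuousAt, tendsto_iff_norm_sub_tendsto_zero]
  have key : ∀ y, ‖F y - F x‖ ^ 2 =
      (⟪F y, F y⟫_ℂ).re - 2 * (⟪F y, F x⟫_ℂ).re + (⟪F x, F x⟫_ℂ).re := by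
    intro y
    rw [norm_sub_sq (𝕜 := ℂ), ← inner_self_eq_norm_sq (𝕜 := ℂ), ← inner_self_eq_norm_sq (𝕜 := ℂ)]
    simp only [RCLike.re_to_complex]
  have hc : Tendsto (fun y => ‖F y - F x‖ ^ 2) (𝓝 x) (𝓝 0) := by
    simp_rw [key]
    have h1 : Continuous fun y => ⟪F y, F y⟫_ℂ := h.comp (continuous_id.prodMk continuous_id)
    have h2 : Continuous fun y => ⟪F y, F x⟫_ℂ := h.comp (continuous_id.prodMk continuous_const)
    have : Continuous fun y => (⟪F y, F y⟫_ℂ).re - 2 * (⟪F y, F x⟫_ℂ).re + (⟪F x, F x⟫_ℂ).re := by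
      fun_prop
    have h := this.tendsto x
    have h0 : (⟪F x, F x⟫_ℂ).re - 2 * (⟪F x, F x⟫_ℂ).re + (⟪F x, F x⟫_ℂ).re = 0 := by ring
    rwa [h0] at h
  have := hc.sqrt
  simpa using this

namespace ManyBodySystem

/-! ### Translations and continuity of correlation functions -/

section Translations

variable {A : Type*} [Ring A] [StarRing A] [Algebra ℂ A] [StarModule ℂ A] (S : ManyBodySystem A)

lemma evol_zero_right (a : A) (x : ℝ) : S.evol a x 0 = S.space x a := by
  rw [evol, S.time_zero]

lemma evol_zero_left (a : A) (t : ℝ) : S.evol a 0 t = S.time t a := by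
  rw [evol, S.space_zero]

lemma evol_zero_zero (a : A) : S.evol a 0 0 = a := by
  rw [evol_zero_right, S.space_zero]

lemma state_evol (a : A) (x t : ℝ) : S.state (S.evol a x t) = S.state a := by
  rw [evol, S.state_space, S.state_time]

lemma time_evol (a : A) (x s t : ℝ) : S.time s (S.evol a x t) = S.evol a x (s + t) := by
  rw [evol, evol, ← S.space_time_comm, S.time_add]

lemma conn₂_space (x : ℝ) (a b : A) : S.conn₂ (S.space x a) (S.space x b) = S.conn₂ a b := by
  simp only [conn₂, ← map_mul, S.state_space]

lemma conn₃_time (t : ℝ) (a b c : A) :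
    S.conn₃ (S.time t a) (S.time t b) (S.time t c) = S.conn₃ a b c := by
  simp only [conn₃, conn₂, ← map_mul, S.state_time]

lemma continuous_state_evol₂ (a b : A) : Continuous fun P : (ℝ × ℝ) × (ℝ × ℝ) =>
    S.state (S.evol a P.1.1 P.1.2 * S.evol b P.2.1 P.2.2) := by
  have h := (S.continuous_state a b 1 1).comp
    (by fun_prop : Continuous fun P : (ℝ × ℝ) × (ℝ × ℝ) => (P.1, P.2, P.1, P.1))
  simpa [Function.comp_def, evol] using h

lemma continuous_state_evol₃ (a b c : A) : Continuous fun P : (ℝ × ℝ) × (ℝ × ℝ) × (ℝ × ℝ) =>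
    S.state (S.evol a P.1.1 P.1.2 * S.evol b P.2.1.1 P.2.1.2 * S.evol c P.2.2.1 P.2.2.2) := by
  have h := (S.continuous_state a b c 1).comp
    (by fun_prop : Continuous fun P : (ℝ × ℝ) × (ℝ × ℝ) × (ℝ × ℝ) => (P.1, P.2.1, P.2.2, P.1))
  simpa [Function.comp_def, evol] using h

lemma continuous_conn₂ (a b : A) : Continuous fun P : (ℝ × ℝ) × (ℝ × ℝ) =>
    S.conn₂ (S.evol a P.1.1 P.1.2) (S.evol b P.2.1 P.2.2) := by
  simp only [conn₂, state_evol]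
  exact (S.continuous_state_evol₂ a b).sub continuous_const

lemma continuous_conn₃ (a b c : A) : Continuous fun P : (ℝ × ℝ) × (ℝ × ℝ) × (ℝ × ℝ) =>
    S.conn₃ (S.evol a P.1.1 P.1.2) (S.evol b P.2.1.1 P.2.1.2) (S.evol c P.2.2.1 P.2.2.2) := by
  have h1 := S.continuous_state_evol₃ a b c
  have h2 := (S.continuous_conn₂ b c).comp
    (by fun_prop : Continuous fun P : (ℝ × ℝ) × (ℝ × ℝ) × (ℝ × ℝ) => (P.2.1, P.2.2))
  have h3 := (S.continuous_conn₂ a c).comp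
    (by fun_prop : Continuous fun P : (ℝ × ℝ) × (ℝ × ℝ) × (ℝ × ℝ) => (P.1, P.2.2))
  have h4 := (S.continuous_conn₂ a b).comp
    (by fun_prop : Continuous fun P : (ℝ × ℝ) × (ℝ × ℝ) × (ℝ × ℝ) => (P.1, P.2.1))
  simp only [Function.comp_def] at h2 h3 h4
  simp only [conn₃, state_evol]
  fun_prop

lemma covKernel_eq_conn₂ (a b : A) (x : ℝ) :
    S.covKernel a b x = S.conn₂ (S.space x (star a)) b := by
  rw [covKernel, conn₂, map_star, S.state_star, S.state_space]

lemma covKernel_time (a b : A) (s t x : ℝ) : S.covKernel (S.time s a) (S.time t b) x =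
    S.conn₂ (S.evol (star a) x s) (S.evol b 0 t) := by
  rw [covKernel_eq_conn₂, evol_zero_left, evol, map_star, map_star, map_star]

end Translations

/-! ### Consequences of clustering -/

section Clustering

variable {A : Type*} [Ring A] [StarRing A] [Algebra ℂ A] [StarModule ℂ A] {S : ManyBodySystem A}

/-- The gap m / n from `exists_gap` dominates v times every time difference, so the cone condition
holds automatically across it. -/
lemma separated_of_spread {n : ℕ} (hn : 2 ≤ n) {X : Fin n → ℝ × ℝ} {v m : ℝ} (hm : 0 ≤ m)
    (ht : ∀ i j, v * |(X i).2 - (X j).2| ≤ m / n) {i j : Fin n}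
    (h : m ≤ |(X i).1 - (X j).1|) : Separated v (m / n) X := by
  obtain ⟨s, h1, h2, h3⟩ := exists_gap hn (fun k => (X k).1) hm h
  exact ⟨s, h1, h2, fun k hk l hl => ⟨(ht k l).trans (h3 k hk l hl), h3 k hk l hl⟩⟩

lemma mul_abs_sub_le {v τ s t m : ℝ} (hv : 0 ≤ v) (hs : |s| ≤ τ) (ht : |t| ≤ τ)
    (h : v * (2 * τ) ≤ m) : v * |s - t| ≤ m := by
  refine (mul_le_mul_of_nonneg_left ?_ hv).trans h
  linarith [abs_sub s t]

variable {v p : ℝ}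

/-- At times bounded by τ the cone condition is automatic once |x| ≥ 4vτ; the remaining positions
and times form a compact set, where continuity gives a bound. -/
lemma Clusters.exists_conn₂_le (hcl : S.Clusters v p) (hv : 0 ≤ v) (hp : 0 ≤ p) (a b : A) (τ : ℝ) :
    ∃ C, 0 ≤ C ∧ ∀ s t x : ℝ, |s| ≤ τ → |t| ≤ τ →
      ‖S.conn₂ (S.evol a x s) (S.evol b 0 t)‖ ≤ C * (1 + |x|) ^ (-p) := by
  obtain ⟨C, hC⟩ := hcl.two ![a, b]
  have hf : Continuous (Function.uncurry fun (κ : ℝ × ℝ) (x : ℝ) =>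
      S.conn₂ (S.evol a x κ.1) (S.evol b 0 κ.2)) :=
    (S.continuous_conn₂ a b).comp
      (by fun_prop : Continuous fun P : (ℝ × ℝ) × ℝ => ((P.2, P.1.1), ((0 : ℝ), P.1.2)))
  obtain ⟨C', hC', h⟩ := exists_decay_bound (C := C) (p := p) (M := v * (4 * τ)) (k := 1 / 2) hf
    ((isCompact_Icc (a := -τ) (b := τ)).prod (isCompact_Icc (a := -τ) (b := τ))) hp
    (by norm_num) (by norm_num) (by
      rintro ⟨s, t⟩ ⟨hs, ht⟩ x hx
      have hs' : |s| ≤ τ := abs_le.2 hs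
      have ht' : |t| ≤ τ := abs_le.2 ht
      have hτ : 0 ≤ τ := (abs_nonneg s).trans hs'
      have hM : v * (2 * τ) ≤ |x| / 2 := by
        rw [Real.norm_eq_abs] at hx
        linarith
      have hM0 : 0 ≤ v * (2 * τ) := by positivity
      have hsep : Separated v (|x| / 2) ![(x, s), ((0 : ℝ), t)] := by
        refine separated_of_spread (n := 2) le_rfl (abs_nonneg x) (i := 0) (j := 1) ?_ (by simp)
        intro i j
        fin_cases i <;> fin_cases j <;>
          first
          | simpa using (show (0 : ℝ) ≤ |x| / 2 by positivity)
          | simpa using mul_abs_sub_le hv hs' ht' hM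
          | simpa using mul_abs_sub_le hv ht' hs' hM
      have := hC _ _ (by positivity) hsep
      simpa [div_eq_inv_mul] using this)
  refine ⟨C', hC', fun s t x hs ht => ?_⟩
  exact h (s, t) ⟨abs_le.1 hs, abs_le.1 ht⟩ x

/-- Three-point clustering with the third point at the origin, at bounded time differences. -/
lemma norm_conn₃_le_of_spread {v C p : ℝ} {a b c : A}
    (hC : ∀ (X : Fin 3 → ℝ × ℝ) (d : ℝ), 0 ≤ d → Separated v d X →
      ‖S.conn₃ (S.evol a (X 0).1 (X 0).2) (S.evol b (X 1).1 (X 1).2)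
        (S.evol c (X 2).1 (X 2).2)‖ ≤ C * (1 + d) ^ (-p))
    {r s t y z : ℝ} (h1 : v * |r - s| ≤ ‖(y, z)‖ / 3) (h2 : v * |r - t| ≤ ‖(y, z)‖ / 3)
    (h3 : v * |s - t| ≤ ‖(y, z)‖ / 3) :
    ‖S.conn₃ (S.evol a y r) (S.evol b z s) (S.evol c 0 t)‖ ≤
      C * (1 + ‖(y, z)‖ / 3) ^ (-p) := by
  have hsep : Separated v (‖(y, z)‖ / 3) ![(y, r), (z, s), ((0 : ℝ), t)] := by
    have ht : ∀ i j : Fin 3, v * |((![(y, r), (z, s), ((0 : ℝ), t)] : Fin 3 → ℝ × ℝ) i).2 -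
        ((![(y, r), (z, s), ((0 : ℝ), t)] : Fin 3 → ℝ × ℝ) j).2| ≤ ‖(y, z)‖ / (3 : ℕ) := by
      have h0 : (0 : ℝ) ≤ ‖(y, z)‖ / 3 := by positivity
      intro i j
      fin_cases i <;> fin_cases j
      · simpa using h0
      · simpa using h1
      · simpa using h2
      · rw [abs_sub_comm] at h1; simpa using h1
      · simpa using h0
      · simpa using h3
      · rw [abs_sub_comm] at h2; simpa using h2
      · rw [abs_sub_comm] at h3; simpa using h3
      · simpa using h0
    -- The third point is at the origin, so the sup norm of (y, z) is the distance from it to one of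
    -- the other two.
    rcases le_total |y| |z| with h | h
    · refine separated_of_spread (n := 3) (by norm_num) (norm_nonneg _) ht (i := 1) (j := 2) ?_
      simp [Prod.norm_def, h]
    · refine separated_of_spread (n := 3) (by norm_num) (norm_nonneg _) ht (i := 0) (j := 2) ?_
      simp [Prod.norm_def, h]
  have := hC _ _ (by positivity) hsep
  simpa using this

/-- The argument is that of the two-point case: the threshold 6vτ makes v times any time difference
at most a third of the spread. -/
lemma Clusters.exists_conn₃_le (hcl : S.Clusters v p) (hv : 0 ≤ v) (hp : 0 ≤ p) (a b c : A)
    (τ : ℝ) : ∃ C, 0 ≤ C ∧ ∀ r s t y z : ℝ, |r| ≤ τ → |s| ≤ τ → |t| ≤ τ →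
      ‖S.conn₃ (S.evol a y r) (S.evol b z s) (S.evol c 0 t)‖ ≤ C * (1 + ‖(y, z)‖) ^ (-p) := by
  obtain ⟨C, hC⟩ := hcl.three ![a, b, c]
  simp only [Matrix.cons_val_zero, Matrix.cons_val_one, Matrix.cons_val] at hC
  let f (κ : ℝ × ℝ × ℝ) (x : ℝ × ℝ) : ℂ :=
    S.conn₃ (S.evol a x.1 κ.1) (S.evol b x.2 κ.2.1) (S.evol c 0 κ.2.2)
  have hf : Continuous (Function.uncurry f) := by
    have h := (S.continuous_conn₃ a b c).comp
      (by fun_prop : Continuous fun P : (ℝ × ℝ × ℝ) × (ℝ × ℝ) =>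
        ((P.2.1, P.1.1), (P.2.2, P.1.2.1), ((0 : ℝ), P.1.2.2)))
    exact h.congr fun _ => rfl
  have hfar : ∀ κ ∈ Metric.closedBall (0 : ℝ × ℝ × ℝ) τ, ∀ x, v * (6 * τ) ≤ ‖x‖ →
      ‖f κ x‖ ≤ C * (1 + 1 / 3 * ‖x‖) ^ (-p) := by
    rintro ⟨r, s, t⟩ hκ ⟨y, z⟩ hx
    simp only [mem_closedBall_zero_iff, Prod.norm_def, sup_le_iff, Real.norm_eq_abs] at hκ
    obtain ⟨hr, hs, ht⟩ := hκ
    have hM : v * (2 * τ) ≤ ‖(y, z)‖ / 3 := by linarith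
    have := norm_conn₃_le_of_spread hC (mul_abs_sub_le hv hr hs hM)
      (mul_abs_sub_le hv hr ht hM) (mul_abs_sub_le hv hs ht hM)
    rwa [div_eq_inv_mul, ← one_div] at this
  obtain ⟨C', hC', h⟩ := exists_decay_bound hf (isCompact_closedBall 0 τ) hp
    (by norm_num) (by norm_num) hfar
  refine ⟨C', hC', fun r s t y z hr hs ht => h (r, s, t) ?_ (y, z)⟩
  simp only [mem_closedBall_zero_iff, Prod.norm_def, sup_le_iff, Real.norm_eq_abs]
  exact ⟨hr, hs, ht⟩

/-- Equal-time four-point clustering. -/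
lemma Clusters.exists_conn₄_le (hcl : S.Clusters v p) (hp : 0 ≤ p) (a b c d : A) :
    ∃ C, 0 ≤ C ∧ ∀ x y z : ℝ,
      ‖S.conn₄ (S.space (x + y) a) (S.space x b) c (S.space z d)‖ ≤
        C * ((1 + |x|) ^ (-(p / 3)) * (1 + |y|) ^ (-(p / 3)) * (1 + |z|) ^ (-(p / 3))) := by
  obtain ⟨C, hC⟩ := hcl.four ![a, b, c, d]
  -- A spread of m / 2 among four points leaves a gap m / 8. The power p of m is then shared equally
  -- among x, y and z.
  refine ⟨|C| * (8⁻¹ : ℝ) ^ (-p), by positivity, fun x y z => ?_⟩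
  set m : ℝ := max |x| (max |y| |z|) with hm
  have hx : |x| ≤ m := le_max_left _ _
  have hy : |y| ≤ m := (le_max_left _ _).trans (le_max_right _ _)
  have hz : |z| ≤ m := (le_max_right _ _).trans (le_max_right _ _)
  have hm0 : 0 ≤ m := (abs_nonneg x).trans hx
  have hsep : Separated v (m / 2 / (4 : ℕ)) ![(x + y, (0 : ℝ)), (x, 0), (0, 0), (z, 0)] := by
    have ht : ∀ i j : Fin 4,
        v * |((![(x + y, (0 : ℝ)), (x, 0), (0, 0), (z, 0)] : Fin 4 → ℝ × ℝ) i).2 -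
        ((![(x + y, (0 : ℝ)), (x, 0), (0, 0), (z, 0)] : Fin 4 → ℝ × ℝ) j).2| ≤
          m / 2 / (4 : ℕ) := by
      have h0 : (0 : ℝ) ≤ m / 2 / (4 : ℕ) := by positivity
      intro i j
      fin_cases i <;> fin_cases j <;> simpa using h0
    have hm2 : 0 ≤ m / 2 := by positivity
    have h4 : 2 ≤ 4 := by norm_num
    by_cases h1 : m / 2 ≤ |x|
    · exact separated_of_spread h4 hm2 ht (i := 1) (j := 2) (by simpa using h1)
    by_cases h2 : m / 2 ≤ |z|
    · exact separated_of_spread h4 hm2 ht (i := 3) (j := 2) (by simpa using h2)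
    -- If neither x nor z reaches m / 2, the maximum is |y|, which is the distance between the first
    -- two points.
    push Not at h1 h2
    have h3 : m = |y| := by
      rcases max_choice |x| (max |y| |z|) with h | h
      · rw [← hm] at h; linarith
      · rcases max_choice |y| |z| with h' | h'
        · rw [← hm, h'] at h; exact h
        · rw [← hm, h'] at h; linarith
    refine separated_of_spread h4 hm2 ht (i := 0) (j := 1) ?_
    simp only [Matrix.cons_val_zero, Matrix.cons_val_one, add_sub_cancel_left]
    linarith
  have h1 := hC _ _ (by positivity) hsep
  simp only [Matrix.cons_val_zero, Matrix.cons_val_one, Matrix.cons_val, evol_zero_right,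
    S.space_zero] at h1
  refine h1.trans ?_
  have h2 : (1 + m / 2 / (4 : ℕ)) ^ (-p) ≤ (8⁻¹ : ℝ) ^ (-p) * (1 + m) ^ (-p) := by
    have := one_add_mul_rpow_neg_le (k := 8⁻¹) (m := m) (p := p) (by norm_num) (by norm_num) hm0 hp
    refine le_trans (le_of_eq ?_) this
    congr 1
    push_cast
    ring
  have h3 : (1 + m) ^ (-p) ≤
      (1 + |x|) ^ (-(p / 3)) * (1 + |y|) ^ (-(p / 3)) * (1 + |z|) ^ (-(p / 3)) := by
    have e1 := one_add_rpow_neg_add_le (m := m) (abs_nonneg x) hm0 hx le_rfl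
      (r := p / 3) (s := p / 3 + p / 3) (by positivity) (by positivity)
    have e2 := one_add_rpow_neg_add_le (m := m) (abs_nonneg y) (abs_nonneg z) hy hz
      (r := p / 3) (s := p / 3) (by positivity) (by positivity)
    rw [show p / 3 + (p / 3 + p / 3) = p by ring] at e1
    rw [mul_assoc]
    exact e1.trans (by gcongr)
  rw [mul_assoc]
  exact mul_le_mul (le_abs_self _) (h2.trans (by gcongr)) (by positivity) (abs_nonneg _)

end Clustering

end ManyBodySystem

/-! ### Conserved integrals -/

/-- A differentiable density `f` and current `g` on space-time with `∂_t f + ∂_x g = 0`. -/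
structure IsContinuityPair (f g : ℝ × ℝ → ℂ) : Prop where
  density : Differentiable ℝ f
  current : Differentiable ℝ g
  eq : ∀ P, fderiv ℝ g P (1, 0) + fderiv ℝ f P (0, 1) = 0

namespace IsContinuityPair

variable {f g f' g' : ℝ × ℝ → ℂ}

lemma add (h : IsContinuityPair f g) (h' : IsContinuityPair f' g') :
    IsContinuityPair (fun P => f P + f' P) (fun P => g P + g' P) where
  density := h.density.add h'.density
  current := h.current.add h'.current
  eq P := by
    rw [fderiv_fun_add (h.density P) (h'.density P), fderiv_fun_add (h.current P) (h'.current P)]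
    rw [add_apply, add_apply]
    linear_combination h.eq P + h'.eq P

lemma const_mul (c : ℂ) (h : IsContinuityPair f g) :
    IsContinuityPair (fun P => c * f P) (fun P => c * g P) where
  density := h.density.const_mul c
  current := h.current.const_mul c
  eq P := by
    rw [fderiv_const_mul (h.density P), fderiv_const_mul (h.current P)]
    simp only [smul_apply, smul_eq_mul]
    linear_combination c * h.eq P

/-- The space integral of a density is conserved if density and current decay. -/
lemma integral_eq (h : IsContinuityPair f g) {C r s₁ s₂ : ℝ} (hr : 1 < r)
    (hf : ∀ x, ∀ t ∈ Set.uIcc s₁ s₂, ‖f (x, t)‖ ≤ C * (1 + |x|) ^ (-r))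
    (hg : ∀ x, ∀ t ∈ Set.uIcc s₁ s₂, ‖g (x, t)‖ ≤ C * (1 + |x|) ^ (-r)) :
    ∫ x, f (x, s₁) = ∫ x, f (x, s₂) := by
  have hfc := h.density.continuous
  have hgc := h.current.continuous
  have hint : ∀ t ∈ Set.uIcc s₁ s₂, Integrable fun x => f (x, t) := fun t ht =>
    ((integrable_one_add_abs_rpow hr).const_mul C).mono'
      (by fun_prop : Continuous fun x => f (x, t)).aestronglyMeasurable
      (ae_of_all _ fun x => hf x t ht)
  have hlim : ∀ t ∈ Set.uIcc s₁ s₂,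
      Tendsto (fun L : ℝ => ∫ x in (-L)..L, f (x, t)) atTop (𝓝 (∫ x, f (x, t))) := fun t ht =>
    intervalIntegral_tendsto_integral (hint t ht) tendsto_neg_atTop_atBot tendsto_id
  have hdecay : Tendsto (fun L : ℝ => C * (1 + |L|) ^ (-r) * |s₂ - s₁|) atTop (𝓝 0) := by
    have h1 : Tendsto (fun L : ℝ => (1 + |L|) ^ (-r)) atTop (𝓝 0) :=
      (tendsto_rpow_neg_atTop (by linarith)).comp
        (tendsto_atTop_add_const_left _ _ tendsto_abs_atTop_atTop)
    simpa using (h1.const_mul C).mul_const |s₂ - s₁|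
  have hbd : ∀ L, ‖∫ t in s₁..s₂, g (L, t)‖ ≤ C * (1 + |L|) ^ (-r) * |s₂ - s₁| := fun L =>
    intervalIntegral.norm_integral_le_of_norm_le_const fun t ht =>
      hg L t (Set.uIoc_subset_uIcc ht)
  have hz1 : Tendsto (fun L : ℝ => ∫ t in s₁..s₂, g (L, t)) atTop (𝓝 0) :=
    squeeze_zero_norm hbd hdecay
  have hz2 : Tendsto (fun L : ℝ => ∫ t in s₁..s₂, g (-L, t)) atTop (𝓝 0) :=
    squeeze_zero_norm (fun L => by simpa using hbd (-L)) hdecay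
  -- Divergence theorem on the rectangle [-L, L] × [s₁, s₂]: the change in charge equals the flux
  -- through the two sides, which vanishes as L grows.
  have hdiv : ∀ L : ℝ, (∫ x in (-L)..L, f (x, s₂)) - (∫ x in (-L)..L, f (x, s₁)) =
      (∫ t in s₁..s₂, g (-L, t)) - ∫ t in s₁..s₂, g (L, t) := by
    intro L
    have := integral2_divergence_prod_of_hasFDerivAt g f (fderiv ℝ g) (fderiv ℝ f) (-L) s₁ L s₂
      hgc.continuousOn hfc.continuousOn (fun x _ => (h.current x).hasFDerivAt)
      (fun x _ => (h.density x).hasFDerivAt) (by simp only [h.eq]; exact integrableOn_zero)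
    simp only [h.eq, intervalIntegral.integral_zero] at this
    linear_combination -this
  have h1 := (hlim s₂ Set.right_mem_uIcc).sub (hlim s₁ Set.left_mem_uIcc)
  simp_rw [hdiv] at h1
  have h2 := tendsto_nhds_unique h1 (hz2.sub hz1)
  rw [sub_zero, sub_eq_zero] at h2
  exact h2.symm

end IsContinuityPair

namespace ManyBodySystem

variable {A : Type*} [Ring A] [StarRing A] [Algebra ℂ A] [StarModule ℂ A] {S : ManyBodySystem A}

lemma ConservationLaw.isContinuityPair {q j : A} (h : S.ConservationLaw q j) (b c : A) :
    IsContinuityPair (fun P => S.state (b * S.evol q P.1 P.2 * c))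
      (fun P => S.state (b * S.evol j P.1 P.2 * c)) where
  density := h.differentiable_density b c
  current := h.differentiable_current b c
  eq := by
    rintro ⟨x, t⟩
    have h1 := ((h.differentiable_density b c) (x, t)).hasFDerivAt.comp_hasDerivAt t
      ((hasDerivAt_const t x).prodMk (hasDerivAt_id t))
    have h2 := ((h.differentiable_current b c) (x, t)).hasFDerivAt.comp_hasDerivAt x
      ((hasDerivAt_id x).prodMk (hasDerivAt_const x t))
    rw [← h1.deriv, ← h2.deriv, add_comm]
    exact h.continuity_equation b c x t

/-- The connected function is linear in its first entry, a combination of averages ⟨b' · c'⟩ with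
fixed b' and c' (possibly 1), and each of these obeys the continuity equation. -/
lemma ConservationLaw.isContinuityPair_conn₃_left {q j : A} (h : S.ConservationLaw q j) (b c : A) :
    IsContinuityPair (fun P => S.conn₃ (S.evol q P.1 P.2) b c)
      (fun P => S.conn₃ (S.evol j P.1 P.2) b c) := by
  have key : ∀ a : A, S.conn₃ a b c = S.state (1 * a * (b * c)) +
      (-S.state b * S.state (1 * a * c) + (-S.state c * S.state (1 * a * b) +
        (S.state b * S.state c - S.conn₂ b c) * S.state (1 * a * 1))) := by
    intro a
    simp only [conn₃, conn₂, one_mul, mul_one, mul_assoc]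
    ring
  simp only [key]
  exact (h.isContinuityPair _ _).add (((h.isContinuityPair _ _).const_mul _).add
    (((h.isContinuityPair _ _).const_mul _).add ((h.isContinuityPair _ _).const_mul _)))

lemma ConservationLaw.isContinuityPair_conn₃_right {q j : A} (h : S.ConservationLaw q j)
    (a c : A) : IsContinuityPair (fun P => S.conn₃ a (S.evol q P.1 P.2) c)
      (fun P => S.conn₃ a (S.evol j P.1 P.2) c) := by
  have key : ∀ b : A, S.conn₃ a b c = S.state (a * b * c) +
      (-S.state a * S.state (1 * b * c) + (-S.state c * S.state (a * b * 1) +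
        (S.state a * S.state c - S.conn₂ a c) * S.state (1 * b * 1))) := by
    intro b
    simp only [conn₃, conn₂, one_mul, mul_one, mul_assoc]
    ring
  simp only [key]
  exact (h.isContinuityPair _ _).add (((h.isContinuityPair _ _).const_mul _).add
    (((h.isContinuityPair _ _).const_mul _).add ((h.isContinuityPair _ _).const_mul _)))

variable {v p : ℝ}

lemma one_add_norm_rpow_le_left {p : ℝ} (hp : 0 ≤ p) (y z : ℝ) :
    (1 + ‖(y, z)‖) ^ (-p) ≤ (1 + |y|) ^ (-p) :=
  Real.rpow_le_rpow_of_nonpos (by positivity)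
    (by simp) (by linarith)

lemma one_add_norm_rpow_le_right {p : ℝ} (hp : 0 ≤ p) (y z : ℝ) :
    (1 + ‖(y, z)‖) ^ (-p) ≤ (1 + |z|) ^ (-p) :=
  Real.rpow_le_rpow_of_nonpos (by positivity)
    (by simp) (by linarith)

/-- Clustering is uniform on the compact time window between s₁ and s₂, so density and current decay
there and the total charge is conserved next to the other insertions. -/
lemma Clusters.integral_conn₃_left (hcl : S.Clusters v p) (hv : 0 ≤ v) (hp : 1 < p) {q j : A}
    (h : S.ConservationLaw q j) (b c : A) (z s₁ s₂ r : ℝ) :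
    ∫ y, S.conn₃ (S.evol q y s₁) (S.evol b z r) c =
      ∫ y, S.conn₃ (S.evol q y s₂) (S.evol b z r) c := by
  have hp0 : 0 ≤ p := by linarith
  obtain ⟨C₁, hC₁, h₁⟩ := hcl.exists_conn₃_le hv hp0 q b c (max (max |s₁| |s₂|) |r|)
  obtain ⟨C₂, hC₂, h₂⟩ := hcl.exists_conn₃_le hv hp0 j b c (max (max |s₁| |s₂|) |r|)
  have hb : ∀ t ∈ Set.uIcc s₁ s₂, |t| ≤ max (max |s₁| |s₂|) |r| := fun t ht =>
    (abs_le_max_abs_abs ht.1 ht.2).trans (le_max_of_le_left (by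
      rcases le_total s₁ s₂ with h | h <;> simp [h, le_total]))
  refine (h.isContinuityPair_conn₃_left (S.evol b z r) c).integral_eq (C := C₁ + C₂) hp ?_ ?_
  · intro y t ht
    have e := h₁ t r 0 y z (hb t ht) (le_max_right _ _) (by simp)
    rw [evol_zero_zero] at e
    refine e.trans (mul_le_mul (by linarith) (one_add_norm_rpow_le_left hp0 y z) (by positivity)
      (by positivity))
  · intro y t ht
    have e := h₂ t r 0 y z (hb t ht) (le_max_right _ _) (by simp)
    rw [evol_zero_zero] at e
    refine e.trans (mul_le_mul (by linarith) (one_add_norm_rpow_le_left hp0 y z) (by positivity)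
      (by positivity))

lemma Clusters.integral_conn₃_right (hcl : S.Clusters v p) (hv : 0 ≤ v) (hp : 1 < p) {q j : A}
    (h : S.ConservationLaw q j) (a c : A) (y s₁ s₂ r : ℝ) :
    ∫ z, S.conn₃ (S.evol a y r) (S.evol q z s₁) c =
      ∫ z, S.conn₃ (S.evol a y r) (S.evol q z s₂) c := by
  have hp0 : 0 ≤ p := by linarith
  obtain ⟨C₁, hC₁, h₁⟩ := hcl.exists_conn₃_le hv hp0 a q c (max (max |s₁| |s₂|) |r|)
  obtain ⟨C₂, hC₂, h₂⟩ := hcl.exists_conn₃_le hv hp0 a j c (max (max |s₁| |s₂|) |r|)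
  have hb : ∀ t ∈ Set.uIcc s₁ s₂, |t| ≤ max (max |s₁| |s₂|) |r| := fun t ht =>
    (abs_le_max_abs_abs ht.1 ht.2).trans (le_max_of_le_left (by
      rcases le_total s₁ s₂ with h | h <;> simp [h, le_total]))
  refine (h.isContinuityPair_conn₃_right (S.evol a y r) c).integral_eq (C := C₁ + C₂) hp ?_ ?_
  · intro z t ht
    have e := h₁ r t 0 y z (le_max_right _ _) (hb t ht) (by simp)
    rw [evol_zero_zero] at e
    refine e.trans (mul_le_mul (by linarith) (one_add_norm_rpow_le_right hp0 y z) (by positivity)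
      (by positivity))
  · intro z t ht
    have e := h₂ r t 0 y z (le_max_right _ _) (hb t ht) (by simp)
    rw [evol_zero_zero] at e
    refine e.trans (mul_le_mul (by linarith) (one_add_norm_rpow_le_right hp0 y z) (by positivity)
      (by positivity))

lemma Clusters.integrable_conn₃ (hcl : S.Clusters v p) (hv : 0 ≤ v) (hp : 2 < p) (a b c : A)
    (r s t : ℝ) :
    Integrable fun P : ℝ × ℝ => S.conn₃ (S.evol a P.1 r) (S.evol b P.2 s) (S.evol c 0 t) := by
  obtain ⟨C, hC, h⟩ := hcl.exists_conn₃_le hv (by linarith) a b c (max (max |r| |s|) |t|)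
  have hc : Continuous fun P : ℝ × ℝ =>
      S.conn₃ (S.evol a P.1 r) (S.evol b P.2 s) (S.evol c 0 t) :=
    ((S.continuous_conn₃ a b c).comp (by fun_prop : Continuous fun P : ℝ × ℝ =>
      ((P.1, r), (P.2, s), ((0 : ℝ), t)))).congr fun _ => rfl
  refine ((integrable_one_add_norm (E := ℝ × ℝ) (μ := volume) (r := p) ?_).const_mul C).mono'
    hc.aestronglyMeasurable (ae_of_all _ fun P => ?_)
  · simpa using hp
  · exact h r s t P.1 P.2 (by simp) (by simp) (by simp)

/-- The coupling to the total charges does not depend on the time of the observable. -/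
lemma Clusters.integral_conn₃_eq_coupling (hcl : S.Clusters v p) (hv : 0 ≤ v) (hp : 2 < p)
    {q j q' j' : A} (h : S.ConservationLaw q j) (h' : S.ConservationLaw q' j') (a : A) (t : ℝ) :
    ∫ P : ℝ × ℝ, S.conn₃ (S.evol q P.1 0) (S.evol q' P.2 0) (S.evol a 0 t) =
      S.coupling q q' a := by
  have hp1 : 1 < p := by linarith
  have hi := fun r s => hcl.integrable_conn₃ hv hp q q' a r s 0
  simp only [evol_zero_zero] at hi
  -- Stationarity moves the time dependence from the observable to the two charges.
  have e0 : ∀ P : ℝ × ℝ, S.conn₃ (S.evol q P.1 0) (S.evol q' P.2 0) (S.evol a 0 t) =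
      S.conn₃ (S.evol q P.1 (-t)) (S.evol q' P.2 (-t)) a := by
    intro P
    rw [← S.conn₃_time (-t), time_evol, time_evol, time_evol, neg_add_cancel, add_zero,
      evol_zero_zero]
  simp_rw [e0]
  rw [coupling]
  rw [Measure.volume_eq_prod ℝ ℝ, integral_prod_symm _ (hi _ _)]
  -- The charges are brought to time 0 one at a time; Fubini makes the integral over the charge
  -- being moved the inner one.
  simp_rw [hcl.integral_conn₃_left hv hp1 h q' a _ (-t) 0 (-t)]
  rw [← integral_prod_symm _ (hi _ _), integral_prod _ (hi _ _), integral_prod _ (hi _ _)]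
  simp_rw [hcl.integral_conn₃_right hv hp1 h' q a _ (-t) 0 0]

end ManyBodySystem

/-! ### Correlations of functions on the line -/

lemma norm_intervalIntegral_le_integral {E : Type*} [NormedAddCommGroup E] [NormedSpace ℝ E]
    {f : ℝ → E} {g : ℝ → ℝ} {a b : ℝ} (hg : Integrable g) (h : ∀ x, ‖f x‖ ≤ g x) :
    ‖∫ x in a..b, f x‖ ≤ ∫ x, g x := by
  refine intervalIntegral.norm_integral_le_integral_norm_uIoc.trans ?_
  refine (integral_mono_of_nonneg (ae_of_all _ fun _ => norm_nonneg _) hg.integrableOn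
    (ae_of_all _ h)).trans ?_
  exact setIntegral_le_integral hg (ae_of_all _ fun x => (norm_nonneg _).trans (h x))

/-- The correlation function `b ↦ ∫ f(x) g(x + b) dx`. -/
noncomputable def corr (f g : ℝ → ℂ) (b : ℝ) : ℂ := ∫ x, f x * g (x + b)

/-- As a convolution with the reflected function, `corr` inherits continuity, integrability and the
product formula for its integral. -/
lemma corr_eq_convolution (f g : ℝ → ℂ) :
    corr f g = convolution (fun x => f (-x)) g (ContinuousLinearMap.mul ℝ ℂ) volume := by
  ext b
  rw [corr, convolution_def, ← integral_neg_eq_self]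
  simp [sub_eq_neg_add]

section Corr

variable {f g : ℝ → ℂ}

lemma continuous_corr (hf : Integrable f) (hgc : Continuous g) {B : ℝ} (hB : ∀ x, ‖g x‖ ≤ B) :
    Continuous (corr f g) := by
  rw [corr_eq_convolution]
  exact BddAbove.continuous_convolution_right_of_integrable _ ⟨B, by rintro _ ⟨x, rfl⟩; exact hB x⟩
    hf.comp_neg hgc

lemma integrable_corr (hf : Integrable f) (hg : Integrable g) : Integrable (corr f g) := by
  rw [corr_eq_convolution]
  exact hf.comp_neg.integrable_convolution _ hg

lemma integral_corr (hf : Integrable f) (hg : Integrable g) :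
    ∫ b, corr f g b = (∫ x, f x) * ∫ x, g x := by
  rw [corr_eq_convolution, integral_convolution _ hf.comp_neg hg, integral_neg_eq_self f]
  rfl

end Corr

/-- Averages over a square of a function that is, up to a remainder decaying in both variables, a
sum of functions of the sum and of the difference. -/
lemma tendsto_average_of_split {G : ℝ → ℝ → ℂ} {f₁ f₂ : ℝ → ℂ}
    (hG : Continuous fun P : ℝ × ℝ => G P.1 P.2) (hc₁ : Continuous f₁) (hc₂ : Continuous f₂)
    (hi₁ : Integrable f₁) (hi₂ : Integrable f₂) {C r : ℝ} (hr : 1 < r)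
    (h : ∀ y y', ‖G y y' - f₁ (y + y') - f₂ (y - y')‖ ≤
      C * (1 + |y|) ^ (-r) * (1 + |y'|) ^ (-r)) :
    Tendsto (fun R : ℝ => ((2 * R : ℝ) : ℂ)⁻¹ * ∫ y in (-R)..R, ∫ y' in (-R)..R, G y y') atTop
      (𝓝 ((∫ u, f₁ u) + ∫ u, f₂ u)) := by
  have hi := integrable_one_add_abs_rpow hr
  set κ : ℝ := ∫ x : ℝ, (1 + |x|) ^ (-r) with hκ
  set c : ℝ → ℝ → ℂ := fun y y' => G y y' - f₁ (y + y') - f₂ (y - y') with hc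
  have hcc : Continuous fun P : ℝ × ℝ => c P.1 P.2 := by fun_prop
  have hlim : Tendsto (fun R : ℝ => ((2 * R : ℝ) : ℂ)⁻¹ *
      ∫ y in (-R)..R, ∫ y' in (-R)..R, c y y') atTop (𝓝 0) := by
    -- The remainder is integrable over the plane, so its integrals over squares stay bounded and
    -- the factor 1 / 2R kills them.
    have hb : ∀ R : ℝ, ‖∫ y in (-R)..R, ∫ y' in (-R)..R, c y y'‖ ≤ C * κ * κ := by
      intro R
      refine (norm_intervalIntegral_le_integral (hi.const_mul (C * κ)) fun y => ?_).trans
        (le_of_eq ?_)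
      · refine (norm_intervalIntegral_le_integral (hi.const_mul
          (C * (1 + |y|) ^ (-r))) (h y)).trans (le_of_eq ?_)
        rw [integral_const_mul, ← hκ]
        ring
      · rw [integral_const_mul]
    have hz : Tendsto (fun R : ℝ => (2 * R)⁻¹ * (C * κ * κ)) atTop (𝓝 0) := by
      have := (tendsto_inv_atTop_zero.comp
        (tendsto_id.const_mul_atTop (two_pos : (0 : ℝ) < 2))).mul_const (C * κ * κ)
      simpa using this
    refine squeeze_zero_norm' ?_ hz
    filter_upwards [eventually_gt_atTop 0] with R hR
    rw [norm_mul, norm_inv, Complex.norm_real, Real.norm_of_nonneg (by positivity)]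
    exact mul_le_mul_of_nonneg_left (hb R) (by positivity)
  have hsum := (hlim.add (tendsto_average_sub hc₁ hi₁)).add (tendsto_average_sub hc₂ hi₂)
  rw [zero_add] at hsum
  refine hsum.congr fun R => ?_
  rw [← mul_add, ← mul_add]
  congr 1
  have hs : ∀ y, ∫ y' in (-R)..R, G y y' =
      (∫ y' in (-R)..R, c y y') + (∫ y' in (-R)..R, f₁ (y - y')) +
        ∫ y' in (-R)..R, f₂ (y - y') := by
    intro y
    have k1 : Continuous fun y' => c y y' := hcc.comp (by fun_prop : Continuous fun y' => (y, y'))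
    have k2 : Continuous fun y' => f₁ (y + y') := by fun_prop
    have k3 : Continuous fun y' => f₂ (y - y') := by fun_prop
    have k12 : Continuous fun y' => c y y' + f₁ (y + y') := k1.add k2
    -- On a symmetric interval, y' ↦ -y' turns a function of the sum into a function of the
    -- difference.
    have k4 : ∫ y' in (-R)..R, f₁ (y - y') = ∫ y' in (-R)..R, f₁ (y + y') := by
      have := intervalIntegral.integral_comp_neg (a := -R) (b := R) (fun y' => f₁ (y + y'))
      simpa [sub_eq_add_neg] using this
    rw [k4, ← intervalIntegral.integral_add (k1.intervalIntegrable _ _)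
      (k2.intervalIntegrable _ _), ← intervalIntegral.integral_add
      (k12.intervalIntegrable _ _) (k3.intervalIntegrable _ _)]
    refine intervalIntegral.integral_congr fun y' _ => ?_
    simp only [hc]
    ring
  have m1 : Continuous fun y => ∫ y' in (-R)..R, c y y' :=
    intervalIntegral.continuous_parametric_intervalIntegral_of_continuous' hcc _ _
  have m2 : Continuous fun y => ∫ y' in (-R)..R, f₁ (y - y') :=
    intervalIntegral.continuous_parametric_intervalIntegral_of_continuous'
      (f := fun y y' => f₁ (y - y')) (by fun_prop) _ _
  have m3 : Continuous fun y => ∫ y' in (-R)..R, f₂ (y - y') :=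
    intervalIntegral.continuous_parametric_intervalIntegral_of_continuous'
      (f := fun y y' => f₂ (y - y')) (by fun_prop) _ _
  have m12 : Continuous fun y => (∫ y' in (-R)..R, c y y') + ∫ y' in (-R)..R, f₁ (y - y') :=
    m1.add m2
  simp_rw [hs]
  rw [intervalIntegral.integral_add (m12.intervalIntegrable _ _)
    (m3.intervalIntegrable _ _), intervalIntegral.integral_add (m1.intervalIntegrable _ _)
    (m2.intervalIntegrable _ _)]

section InnerIntegral

variable {E : Type*} [NormedAddCommGroup E] [InnerProductSpace ℂ E] [CompleteSpace E]

lemma inner_intervalIntegral_right {F : ℝ → E} (hF : Continuous F) (x : E) (a b : ℝ) :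
    ⟪x, ∫ s in a..b, F s⟫_ℂ = ∫ s in a..b, ⟪x, F s⟫_ℂ :=
  ((innerSL ℂ x).intervalIntegral_comp_comm (hF.intervalIntegrable a b)).symm

lemma inner_intervalIntegral_left {F : ℝ → E} (hF : Continuous F) (x : E) (a b : ℝ) :
    ⟪∫ s in a..b, F s, x⟫_ℂ = ∫ s in a..b, ⟪F s, x⟫_ℂ := by
  rw [← inner_conj_symm, inner_intervalIntegral_right hF]
  simp_rw [← inner_conj_symm (𝕜 := ℂ) (F _) x]
  simp only [intervalIntegral, ← integral_conj, map_sub]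

end InnerIntegral

namespace ManyBodySystem

/-! ### Time translations on `H'` -/

section Ballistic

variable {A : Type*} [Ring A] [StarRing A] [Algebra ℂ A] [StarModule ℂ A] (S : ManyBodySystem A)

lemma inner_timeH (t : ℝ) (φ ψ : S.H') : ⟪S.timeH t φ, S.timeH t ψ⟫_ℂ = ⟪φ, ψ⟫_ℂ := by
  refine S.denseRange_cls.induction_on₂ (p := fun φ ψ => ⟪S.timeH t φ, S.timeH t ψ⟫_ℂ = ⟪φ, ψ⟫_ℂ)
    ?_ ?_ φ ψ
  · exact isClosed_eq (by fun_prop) (by fun_prop)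
  · intro a b
    rw [timeH_cls, timeH_cls, inner_cls, inner_cls, covForm_time]

lemma mem_ballistic_iff (φ : S.H') : φ ∈ S.ballistic ↔ ∀ t, S.timeH t φ = φ := by
  simp [ballistic, Submodule.mem_iInf, sub_eq_zero]

/-- Time translation is isometric and fixes ballistic vectors, so τ_t(ψ - Pψ) stays orthogonal to
the ballistic space. -/
lemma projBal_timeH (t : ℝ) (ψ : S.H') : S.projBal (S.timeH t ψ) = S.projBal ψ := by
  have hP : S.projBal ψ ∈ S.ballistic := S.ballistic.starProjection_apply_mem ψ
  refine (Submodule.eq_starProjection_of_mem_of_inner_eq_zero hP fun φ hφ => ?_)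
  have h1 : ⟪ψ - S.projBal ψ, φ⟫_ℂ = 0 := S.ballistic.starProjection_inner_eq_zero ψ φ hφ
  rw [← h1, ← S.inner_timeH t (ψ - S.projBal ψ) φ, map_sub,
    (S.mem_ballistic_iff _).1 hP t, (S.mem_ballistic_iff _).1 hφ t]

/-- A local representative of the projection turns the integrand of the Onsager element into the
class of a local observable, to which clustering applies. -/
lemma IsBallisticPart.timeH_sub_projBal {S : ManyBodySystem A} {a a₀ : A}
    (h : S.IsBallisticPart a a₀) (t : ℝ) :
    S.timeH t (S.cls a) - S.projBal (S.timeH t (S.cls a)) = S.cls (S.time t (a - a₀)) := by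
  have h0 : S.cls a₀ ∈ S.ballistic := by
    rw [h]; exact S.ballistic.starProjection_apply_mem _
  rw [projBal_timeH, ← h, ← timeH_cls, map_sub, map_sub, (S.mem_ballistic_iff _).1 h0 t]

/-- The Gram kernel is a space integral of covariances; the locally uniform bound makes it
continuous by dominated convergence. -/
lemma continuous_cls_of_bound {F : ℝ → A}
    (hc : Continuous fun P : (ℝ × ℝ) × ℝ => S.covKernel (F P.1.1) (F P.1.2) P.2)
    (hb : ∀ τ, ∃ C r : ℝ, 1 < r ∧ ∀ s t x, |s| ≤ τ → |t| ≤ τ →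
      ‖S.covKernel (F s) (F t) x‖ ≤ C * (1 + |x|) ^ (-r)) :
    Continuous fun s => S.cls (F s) := by
  refine continuous_of_continuous_inner ?_
  simp_rw [inner_cls, covForm]
  rw [continuous_iff_continuousAt]
  intro P₀
  obtain ⟨C, r, hr, h⟩ := hb (‖P₀‖ + 1)
  refine continuousAt_of_dominated (bound := fun x => C * (1 + |x|) ^ (-r)) ?_ ?_
    ((integrable_one_add_abs_rpow hr).const_mul C) ?_
  · exact Eventually.of_forall fun P =>
      (hc.comp (by fun_prop : Continuous fun x : ℝ => (P, x))).aestronglyMeasurable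
  · have hev : ∀ᶠ P : ℝ × ℝ in 𝓝 P₀, ‖P‖ < ‖P₀‖ + 1 :=
      continuous_norm.continuousAt.eventually_lt continuousAt_const (by simp)
    filter_upwards [hev] with P hP
    exact ae_of_all _ fun x => h _ _ x ((norm_fst_le P).trans hP.le) ((norm_snd_le P).trans hP.le)
  · exact ae_of_all _ fun x =>
      (hc.comp (by fun_prop : Continuous fun P : ℝ × ℝ => (P, x))).continuousAt

end Ballistic

/-! ### Quadratic test vectors: Wick decomposition and growth of the norm -/

section Quadratic

variable {A : Type*} [Ring A] [StarRing A] [Algebra ℂ A] [StarModule ℂ A] {S : ManyBodySystem A}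
  {v p : ℝ}

lemma Clusters.continuous_cls_time (hcl : S.Clusters v p) (hv : 0 ≤ v) (hp : 1 < p) (a : A) :
    Continuous fun t => S.cls (S.time t a) := by
  refine S.continuous_cls_of_bound ?_ fun τ => ?_
  · simp_rw [covKernel_time]
    exact ((S.continuous_conn₂ (star a) a).comp (by fun_prop : Continuous fun P : (ℝ × ℝ) × ℝ =>
      ((P.2, P.1.1), ((0 : ℝ), P.1.2)))).congr fun _ => rfl
  · obtain ⟨C, hC, h⟩ := hcl.exists_conn₂_le hv (by linarith) (star a) a τ
    exact ⟨C, p, hp, fun s t x hs ht => by rw [covKernel_time]; exact h s t x hs ht⟩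

lemma Clusters.exists_covKernel_le (hcl : S.Clusters v p) (hv : 0 ≤ v) {r : ℝ} (hr : 0 ≤ r)
    (hrp : r ≤ p) (a b : A) :
    ∃ C, 0 ≤ C ∧ ∀ x, ‖S.covKernel a b x‖ ≤ C * (1 + |x|) ^ (-r) := by
  obtain ⟨C, hC, h⟩ := hcl.exists_conn₂_le hv (hr.trans hrp) (star a) b 0
  refine ⟨C, hC, fun x => ?_⟩
  have := h 0 0 x (by simp) (by simp)
  rw [evol_zero_zero, evol_zero_right, ← covKernel_eq_conn₂] at this
  refine this.trans (mul_le_mul_of_nonneg_left ?_ hC)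
  exact Real.rpow_le_rpow_of_exponent_le (by linarith [abs_nonneg x]) (by linarith)

lemma Clusters.exists_norm_covKernel_le (hcl : S.Clusters v p) (hv : 0 ≤ v) (hp : 0 ≤ p)
    (a b : A) : ∃ B, ∀ x, ‖S.covKernel a b x‖ ≤ B := by
  obtain ⟨C, -, h⟩ := hcl.exists_covKernel_le hv le_rfl hp a b
  exact ⟨C, fun x => by simpa using h x⟩

variable (S) in
/-- The product `q'(0) q(y)` of two densities at distance `y`. -/
def quad (q q' : A) (y : ℝ) : A := q' * S.space y q

variable {q q' : A}

/-- For centred densities only pairings survive next to the connected four-point function. The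
covariance removes the pairing inside each product, leaving the two that join different products. -/
lemma covKernel_quad (hq : star q = q) (hq' : star q' = q') (h0 : S.state q = 0)
    (h0' : S.state q' = 0) (y y' x : ℝ) :
    S.covKernel (S.quad q q' y) (S.quad q q' y') x =
      S.conn₄ (S.space (x + y) q) (S.space x q') q' (S.space y' q) +
        S.covKernel q' q (x - y') * S.covKernel q q' (x + y) +
        S.covKernel q' q' x * S.covKernel q q (x + y - y') := by
  have e1 : S.conn₂ (S.space x q') (S.space y' q) = S.covKernel q' q (x - y') := by
    rw [covKernel_eq_conn₂, hq', ← S.conn₂_space y' (S.space (x - y') q'), ← S.space_add,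
      add_sub_cancel]
  have e2 : S.conn₂ (S.space (x + y) q) (S.space y' q) = S.covKernel q q (x + y - y') := by
    rw [covKernel_eq_conn₂, hq, ← S.conn₂_space y' (S.space (x + y - y') q), ← S.space_add,
      add_sub_cancel]
  have e3 : S.conn₂ (S.space (x + y) q) q' = S.covKernel q q' (x + y) := by
    rw [covKernel_eq_conn₂, hq]
  have e4 : S.conn₂ (S.space x q') q' = S.covKernel q' q' x := by
    rw [covKernel_eq_conn₂, hq']
  rw [← e1, ← e2, ← e3, ← e4, covKernel_eq_conn₂, quad, quad, star_mul, hq', ← map_star, hq,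
    map_mul, ← S.space_add]
  have e5 : S.conn₂ (S.space (x + y) q) (S.space x q') =
      S.state (S.space (x + y) q * S.space x q') := by
    simp [conn₂, S.state_space, h0]
  have e6 : S.conn₂ q' (S.space y' q) = S.state (q' * S.space y' q) := by
    simp [conn₂, h0']
  rw [conn₄, e5, e6, S.state_space, S.state_space, S.state_space, h0, h0', conn₂, ← mul_assoc]
  ring

/-- Taking the adjoint restores the order q q', and centring reduces both sides to ⟨q q' a⟩ - ⟨q
q'⟩⟨a⟩. -/
lemma covKernel_quad_time (hq : star q = q) (hq' : star q' = q') (h0 : S.state q = 0)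
    (h0' : S.state q' = 0) (a : A) (y t x : ℝ) :
    S.covKernel (S.quad q q' y) (S.time t a) x =
      S.conn₃ (S.evol q (x + y) 0) (S.evol q' x 0) (S.evol a 0 t) := by
  rw [covKernel_eq_conn₂, quad, star_mul, hq', ← map_star, hq, map_mul, ← S.space_add,
    evol_zero_right, evol_zero_right, evol_zero_left, conn₃, S.state_space, S.state_space, h0, h0']
  simp only [conn₂, S.state_space, h0]
  ring

lemma continuous_covKernel_quad (q q' : A) : Continuous fun P : (ℝ × ℝ) × ℝ =>
    S.covKernel (S.quad q q' P.1.1) (S.quad q q' P.1.2) P.2 := by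
  have h1 := (S.continuous_state (star q) (star q') q' q).comp
    (by fun_prop : Continuous fun P : (ℝ × ℝ) × ℝ => ((P.2 + P.1.1, (0 : ℝ)), (P.2, (0 : ℝ)),
      ((0 : ℝ), (0 : ℝ)), (P.1.2, (0 : ℝ))))
  have h2 := (S.continuous_state_evol₂ q' q).comp
    (by fun_prop : Continuous fun y : ℝ => (((0 : ℝ), (0 : ℝ)), (y, (0 : ℝ))))
  simp only [Function.comp_def, evol_zero_right, S.space_zero, S.time_zero] at h1 h2
  have h3 := (Complex.continuous_conj.comp (h2.comp
    (by fun_prop : Continuous fun P : (ℝ × ℝ) × ℝ => P.1.1))).mul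
    (h2.comp (by fun_prop : Continuous fun P : (ℝ × ℝ) × ℝ => P.1.2))
  refine (h1.sub h3).congr fun P => ?_
  simp only [covKernel, quad, Pi.sub_apply, Pi.mul_apply, Function.comp_apply, star_mul,
    map_mul, S.space_add, map_star, mul_assoc]

/-- Peetre's inequality, from 1 + |x| ≤ (1 + |y|)(1 + |x - y|); it absorbs bounded shifts of x into
a constant. -/
lemma one_add_abs_sub_rpow_le {r : ℝ} (hr : 0 ≤ r) (x y : ℝ) :
    (1 + |x - y|) ^ (-r) ≤ (1 + |y|) ^ r * (1 + |x|) ^ (-r) := by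
  have hx : (0 : ℝ) < 1 + |x| := by positivity
  have hy : (0 : ℝ) < 1 + |y| := by positivity
  have hxy : (0 : ℝ) < 1 + |x - y| := by positivity
  rw [Real.rpow_neg hx.le, Real.rpow_neg hxy.le, ← div_eq_mul_inv, inv_eq_one_div,
    div_le_div_iff₀ (by positivity) (by positivity), one_mul, ← Real.mul_rpow hy.le hxy.le]
  refine Real.rpow_le_rpow hx.le ?_ hr
  have : |x| ≤ |y| + |x - y| := by
    have := abs_add_le y (x - y); rwa [add_sub_cancel] at this
  nlinarith [abs_nonneg y, abs_nonneg (x - y)]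

lemma Clusters.continuous_cls_quad (hcl : S.Clusters v p) (hv : 0 ≤ v) (hp : 3 < p)
    (hq : star q = q) (hq' : star q' = q') (h0 : S.state q = 0) (h0' : S.state q' = 0) :
    Continuous fun y => S.cls (S.quad q q' y) := by
  refine S.continuous_cls_of_bound (continuous_covKernel_quad q q') fun τ => ?_
  have hr : 1 < p / 3 := by linarith
  have hr0 : 0 ≤ p / 3 := by linarith
  obtain ⟨C₄, hC₄, h₄⟩ := hcl.exists_conn₄_le (by linarith) q q' q' q
  obtain ⟨C₁, hC₁, h₁⟩ := hcl.exists_covKernel_le hv hr0 (by linarith) q' q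
  obtain ⟨C₂, hC₂, h₂⟩ := hcl.exists_covKernel_le hv hr0 (by linarith) q q'
  obtain ⟨C₃, hC₃, h₃⟩ := hcl.exists_covKernel_le hv hr0 (by linarith) q' q'
  obtain ⟨C₅, hC₅, h₅⟩ := hcl.exists_covKernel_le hv hr0 (by linarith) q q
  have hone : ∀ x : ℝ, (1 + |x|) ^ (-(p / 3)) ≤ 1 := fun x =>
    Real.rpow_le_one_of_one_le_of_nonpos (by linarith [abs_nonneg x]) (by linarith)
  refine ⟨C₄ + C₁ * (1 + |τ|) ^ (p / 3) * C₂ + C₃ * C₅, p / 3, hr, fun y y' x hy hy' => ?_⟩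
  rw [covKernel_quad hq hq' h0 h0']
  have e1 : ‖S.conn₄ (S.space (x + y) q) (S.space x q') q' (S.space y' q)‖ ≤
      C₄ * (1 + |x|) ^ (-(p / 3)) := by
    refine (h₄ x y y').trans (mul_le_mul_of_nonneg_left ?_ hC₄)
    calc _ ≤ (1 + |x|) ^ (-(p / 3)) * 1 * 1 := by gcongr <;> exact hone _
      _ = _ := by ring
  have e2 : ‖S.covKernel q' q (x - y') * S.covKernel q q' (x + y)‖ ≤
      C₁ * ((1 + |τ|) ^ (p / 3) * (1 + |x|) ^ (-(p / 3))) * (C₂ * 1) := by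
    rw [norm_mul]
    gcongr
    · refine (h₁ _).trans (mul_le_mul_of_nonneg_left ?_ hC₁)
      refine (one_add_abs_sub_rpow_le hr0 x y').trans ?_
      have := hy'.trans (le_abs_self τ)
      exact mul_le_mul_of_nonneg_right (Real.rpow_le_rpow (by positivity) (by linarith) hr0)
        (by positivity)
    · exact (h₂ _).trans (mul_le_mul_of_nonneg_left (hone _) hC₂)
  have e3 : ‖S.covKernel q' q' x * S.covKernel q q (x + y - y')‖ ≤
      C₃ * (1 + |x|) ^ (-(p / 3)) * (C₅ * 1) := by
    rw [norm_mul]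
    gcongr
    · exact h₃ _
    · exact (h₅ _).trans (mul_le_mul_of_nonneg_left (hone _) hC₅)
  refine (norm_add₃_le).trans ((add_le_add (add_le_add e1 e2) e3).trans (le_of_eq ?_))
  ring

variable (S) in
/-- The test vector `∫_{-R}^{R} dy q'(0) q(y)` in `H'`. -/
noncomputable def quadVec (q q' : A) (R : ℝ) : S.H' := ∫ y in (-R)..R, S.cls (S.quad q q' y)

/-- Integration over x turns the pairings into correlations: the crossed one depends on y + y' after
shifting x by y', the direct one on y - y'. -/
lemma covForm_quad (hcl : S.Clusters v p) (hv : 0 ≤ v) (hp : 0 ≤ p)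
    (hq : star q = q) (hq' : star q' = q') (h0 : S.state q = 0) (h0' : S.state q' = 0)
    (y y' : ℝ) : S.covForm (S.quad q q' y) (S.quad q q' y') =
      (∫ x, S.conn₄ (S.space (x + y) q) (S.space x q') q' (S.space y' q)) +
        corr (S.covKernel q' q) (S.covKernel q q') (y + y') +
        corr (S.covKernel q' q') (S.covKernel q q) (y - y') := by
  obtain ⟨B₁, hB₁⟩ := hcl.exists_norm_covKernel_le hv hp q q'
  obtain ⟨B₂, hB₂⟩ := hcl.exists_norm_covKernel_le hv hp q q
  have i1 : Integrable fun x => S.covKernel q' q (x - y') * S.covKernel q q' (x + y) :=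
    ((S.integrable_covKernel q' q).comp_sub_right y').mul_bdd (c := B₁)
      ((S.continuous_covKernel q q').comp (continuous_add_const y)).aestronglyMeasurable
      (ae_of_all _ fun x => hB₁ _)
  have i2 : Integrable fun x => S.covKernel q' q' x * S.covKernel q q (x + y - y') :=
    (S.integrable_covKernel q' q').mul_bdd (c := B₂)
      ((S.continuous_covKernel q q).comp
        (by fun_prop : Continuous fun x : ℝ => x + y - y')).aestronglyMeasurable
      (ae_of_all _ fun x => hB₂ _)
  -- Integrability of the four-point term is read off by subtracting the pairings from the full
  -- kernel.
  have i3 : Integrable fun x =>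
      S.conn₄ (S.space (x + y) q) (S.space x q') q' (S.space y' q) := by
    have := ((S.integrable_covKernel (S.quad q q' y) (S.quad q q' y')).sub i1).sub i2
    refine this.congr (ae_of_all _ fun x => ?_)
    simp only [Pi.sub_apply, covKernel_quad hq hq' h0 h0']
    ring
  have j1 : corr (S.covKernel q' q) (S.covKernel q q') (y + y') =
      ∫ x, S.covKernel q' q (x - y') * S.covKernel q q' (x + y) := by
    rw [corr, ← integral_sub_right_eq_self _ y']
    congr 1
    ext x
    rw [show x - y' + (y + y') = x + y by ring]
  have j2 : corr (S.covKernel q' q') (S.covKernel q q) (y - y') =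
      ∫ x, S.covKernel q' q' x * S.covKernel q q (x + y - y') := by
    simp only [corr, add_sub_assoc]
  have i4 : Integrable fun x => S.conn₄ (S.space (x + y) q) (S.space x q') q' (S.space y' q) +
      S.covKernel q' q (x - y') * S.covKernel q q' (x + y) := i3.add i1
  rw [j1, j2, ← integral_add i3 i1, ← integral_add i4 i2, covForm]
  congr 1
  ext x
  exact covKernel_quad hq hq' h0 h0' y y' x

/-- The squared norm of the test vector grows linearly in `R`, the rate being given by the Wick
pairings of the two densities. -/
lemma Clusters.tendsto_inner_quadVec (hcl : S.Clusters v p) (hv : 0 ≤ v) (hp : 3 < p)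
    (hq : star q = q) (hq' : star q' = q') (h0 : S.state q = 0) (h0' : S.state q' = 0) :
    Tendsto (fun R : ℝ => ((2 * R : ℝ) : ℂ)⁻¹ * ⟪S.quadVec q q' R, S.quadVec q q' R⟫_ℂ) atTop
      (𝓝 (S.covForm q' q * S.covForm q q' + S.covForm q' q' * S.covForm q q)) := by
  have hp0 : 0 ≤ p := by linarith
  have hcont := hcl.continuous_cls_quad hv hp hq hq' h0 h0'
  have hr : 1 < p / 3 := by linarith
  obtain ⟨C₄, hC₄, h₄⟩ := hcl.exists_conn₄_le hp0 q q' q' q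
  obtain ⟨B₁, hB₁⟩ := hcl.exists_norm_covKernel_le hv hp0 q q'
  obtain ⟨B₂, hB₂⟩ := hcl.exists_norm_covKernel_le hv hp0 q q
  have hG : Continuous fun P : ℝ × ℝ => S.covForm (S.quad q q' P.1) (S.quad q q' P.2) := by
    simp_rw [← inner_cls]
    exact (hcont.comp continuous_fst).inner (hcont.comp continuous_snd)
  have hi := integrable_one_add_abs_rpow hr
  -- What remains beyond the pairings is the four-point term integrated over x, a product of decays
  -- in y and y', each integrable because p / 3 > 1.
  have hrest : ∀ y y', ‖S.covForm (S.quad q q' y) (S.quad q q' y') -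
      corr (S.covKernel q' q) (S.covKernel q q') (y + y') -
      corr (S.covKernel q' q') (S.covKernel q q) (y - y')‖ ≤
      C₄ * (∫ x : ℝ, (1 + |x|) ^ (-(p / 3))) * (1 + |y|) ^ (-(p / 3)) *
        (1 + |y'|) ^ (-(p / 3)) := by
    intro y y'
    rw [covForm_quad hcl hv hp0 hq hq' h0 h0' y y', add_sub_right_comm, add_sub_cancel_right,
      add_sub_cancel_right]
    refine (norm_integral_le_of_norm_le (hi.mul_const
      (C₄ * ((1 + |y|) ^ (-(p / 3)) * (1 + |y'|) ^ (-(p / 3)))))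
      (ae_of_all _ fun x => (h₄ x y y').trans (le_of_eq (by ring)))).trans (le_of_eq ?_)
    rw [integral_mul_const]
    ring
  have hlim := tendsto_average_of_split hG
    (continuous_corr (S.integrable_covKernel _ _) (S.continuous_covKernel _ _) hB₁)
    (continuous_corr (S.integrable_covKernel _ _) (S.continuous_covKernel _ _) hB₂)
    (integrable_corr (S.integrable_covKernel q' q) (S.integrable_covKernel q q'))
    (integrable_corr (S.integrable_covKernel q' q') (S.integrable_covKernel q q)) hr hrest
  rw [integral_corr (S.integrable_covKernel _ _) (S.integrable_covKernel _ _),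
    integral_corr (S.integrable_covKernel _ _) (S.integrable_covKernel _ _)] at hlim
  refine hlim.congr fun R => ?_
  congr 1
  rw [quadVec, inner_intervalIntegral_left hcont]
  refine intervalIntegral.integral_congr fun y _ => ?_
  simp only [inner_intervalIntegral_right hcont, inner_cls]

end Quadratic

end ManyBodySystem

/-! ### Decay away from the ballistic trajectories -/

/-- A power is monotone in one direction or the other, so one endpoint value dominates; the sum
covers both signs of s. -/
lemma rpow_le_add_rpow {lo hi ρ : ℝ} (s : ℝ) (hlo : 0 < lo) (h1 : lo ≤ ρ) (h2 : ρ ≤ hi) :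
    ρ ^ s ≤ lo ^ s + hi ^ s := by
  have hρ : 0 < ρ := hlo.trans_le h1
  have hhi : 0 < hi := hρ.trans_le h2
  rcases le_total 0 s with hs | hs
  · linarith [Real.rpow_le_rpow hρ.le h2 hs, Real.rpow_nonneg hlo.le s]
  · linarith [Real.rpow_le_rpow_of_nonpos hlo h1 hs, Real.rpow_nonneg hhi.le s]

/-- On the scale `w ∼ t`, a finite sum of terms `t ^ (-ν) * w ^ (ν - β - 1)` is `O (t ^ (-(β + 1)))`. -/
lemma exists_sum_rpow_le (E : Finset ℝ) (β : ℝ) {lo hi : ℝ} (hlo : 0 < lo) (hhi : 0 ≤ hi) :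
    ∃ B, 0 ≤ B ∧ ∀ t w : ℝ, 0 < t → lo * t ≤ w → w ≤ hi * t →
      ∑ ν ∈ E, t ^ (-ν) * w ^ (ν - β - 1) ≤ B * t ^ (-(1 + β)) := by
  refine ⟨∑ ν ∈ E, (lo ^ (ν - β - 1) + hi ^ (ν - β - 1)),
    Finset.sum_nonneg fun ν _ => by positivity, fun t w ht h1 h2 => ?_⟩
  rw [Finset.sum_mul]
  refine Finset.sum_le_sum fun ν _ => ?_
  have hw : w = w / t * t := by field_simp
  have hρ : 0 < w / t := div_pos ((mul_pos hlo ht).trans_le h1) ht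
  have e : t ^ (-ν) * w ^ (ν - β - 1) = (w / t) ^ (ν - β - 1) * t ^ (-(1 + β)) := by
    conv_lhs => rw [hw]
    rw [Real.mul_rpow hρ.le ht.le, mul_left_comm, ← Real.rpow_add ht]
    congr 2
    ring
  rw [e]
  gcongr
  exact rpow_le_add_rpow _ hlo ((le_div_iff₀ ht).2 h1) ((div_le_iff₀ ht).2 h2)

lemma rpow_neg_le_mul_rpow_neg {u w k η : ℝ} (hu : 0 < u) (hk : 0 < k) (hη : 0 ≤ η)
    (h : u ≤ k * w) : w ^ (-η) ≤ k ^ η * u ^ (-η) := by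
  have hw : 0 < w := pos_of_mul_pos_right (hu.trans_le h) hk.le
  have h1 : (k * w) ^ (-η) ≤ u ^ (-η) := Real.rpow_le_rpow_of_nonpos hu h (by linarith)
  calc w ^ (-η) = k ^ η * (k * w) ^ (-η) := by
        rw [Real.mul_rpow hk.le hw.le, ← mul_assoc, ← Real.rpow_add hk, add_neg_cancel,
          Real.rpow_zero, one_mul]
    _ ≤ _ := by gcongr

namespace ManyBodySystem

variable {A : Type*} [Ring A] [StarRing A] [Algebra ℂ A] [StarModule ℂ A] {S : ManyBodySystem A}
  {v p : ℝ}

/-- A pair at distance at least `ε |t|`, one point of which is outside the cone of the third. -/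
lemma norm_conn₃_le_of_outside_cone {a b c : A} {C ε : ℝ} (hv : 0 < v)
    (hC : ∀ (X : Fin 3 → ℝ × ℝ) (d : ℝ), 0 ≤ d → Separated v d X →
      ‖S.conn₃ (S.evol a (X 0).1 (X 0).2) (S.evol b (X 1).1 (X 1).2)
        (S.evol c (X 2).1 (X 2).2)‖ ≤ C * (1 + d) ^ (-p)) (hε : 0 < ε)
    {y z t : ℝ} (hyz : ε * |t| ≤ |y - z|) (h : v * |t| ≤ |y| ∨ v * |t| ≤ |z|) :
    ‖S.conn₃ (S.evol a y 0) (S.evol b z 0) (S.evol c 0 t)‖ ≤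
      C * (1 + min ε v * |t|) ^ (-p) := by
  have h1 : min ε v * |t| ≤ ε * |t| := by gcongr; exact min_le_left _ _
  have h2 : min ε v * |t| ≤ v * |t| := by gcongr; exact min_le_right _ _
  have h3 : 0 ≤ min ε v * |t| := by
    have := lt_min hε hv
    positivity
  have hzy : ε * |t| ≤ |z - y| := by rwa [abs_sub_comm]
  -- The point outside the cone is isolated as a singleton: from its partner by the equal-time
  -- distance, from the third point by the cone condition.
  have hsep : Separated v (min ε v * |t|) ![(y, (0 : ℝ)), (z, 0), (0, t)] := by
    rcases h with h | h
    · refine ⟨{0}, by simp, ⟨1, by simp⟩, fun i hi j hj => ?_⟩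
      fin_cases i <;> fin_cases j <;> simp at hi hj
      · simpa using h1.trans hyz
      · simpa using ⟨h, h2.trans h⟩
    · refine ⟨{1}, by simp, ⟨0, by simp⟩, fun i hi j hj => ?_⟩
      fin_cases i <;> fin_cases j <;> simp at hi hj
      · simpa using h1.trans hzy
      · simpa using ⟨h, h2.trans h⟩
  simpa using hC _ _ h3 hsep

variable {M : Type*} {N : S.NormalModes M}

/-- Inside both cones, one of the two trajectories is at a distance of order `t`. -/
lemma NormalModes.HydroClusters.exists_conn₃_le_of_mem_cone {a : A} {I J : M}
    (hh : N.HydroClusters v a I J) (hv : 0 < v) {ε : ℝ} (hε : 0 < ε) :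
    ∃ β C T : ℝ, 2 < β ∧ 0 ≤ C ∧ 0 < T ∧ ∀ t x y : ℝ, T ≤ |t| →
      (|N.veff I - N.veff J| + ε) * |t| ≤ |y| → |x + y| ≤ v * |t| → |x| ≤ v * |t| →
      ‖S.conn₃ (S.evol (N.q I) (x + y) 0) (S.evol (N.q J) x 0) (S.evol a 0 t)‖ ≤
        C * |t| ^ (-β) := by
  obtain ⟨α, ⟨hα0, hα1⟩, hα⟩ := hh
  -- Here α < 1 enters: the temporal exponent 1 + 1/α exceeds 2.
  have hα' : 1 < 1 / α := by rw [lt_div_iff₀] <;> linarith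
  obtain ⟨E, C₀, T, hT, hhyd⟩ := hα (ε / 2) (by positivity)
  obtain ⟨B₁, hB₁, hE₁⟩ := exists_sum_rpow_le E (1 / α) (lo := ε / 2) (hi := v + |N.veff I|)
    (by positivity) (by positivity)
  obtain ⟨B₂, hB₂, hE₂⟩ := exists_sum_rpow_le E (1 / α) (lo := ε / 2) (hi := v + |N.veff J|)
    (by positivity) (by positivity)
  refine ⟨1 + 1 / α, |C₀| * (B₁ + B₂), T, by linarith, by positivity, hT,
    fun t x y htT hy hcI hcJ => ?_⟩
  have ht : 0 < |t| := hT.trans_le htT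
  have hpow : 0 ≤ |t| ^ (-(1 + 1 / α)) := by positivity
  obtain ⟨hI, hJ⟩ := hhyd (N.q I) (by simp) (N.q J) (by simp) 0 (x + y) x t htT
  simp only [zero_sub, abs_neg] at hI hJ
  have eI : |-(x + y) - N.veff I * t| ≤ (v + |N.veff I|) * |t| := by
    refine (abs_sub _ _).trans ?_
    rw [abs_neg, abs_mul, add_mul]
    linarith
  have eJ : |-x - N.veff J * t| ≤ (v + |N.veff J|) * |t| := by
    refine (abs_sub _ _).trans ?_
    rw [abs_neg, abs_mul, add_mul]
    linarith
  -- Two points exactly on their trajectories are at distance |v_I - v_J| |t|. The excess ε |t| is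
  -- made up by the two deviations, so one of them is at least ε |t| / 2.
  have htri : |y| ≤ |-(x + y) - N.veff I * t| + |-x - N.veff J * t| +
      |N.veff I - N.veff J| * |t| := by
    rw [← abs_mul]
    have e : y = -(-(x + y) - N.veff I * t) + (-x - N.veff J * t) -
      (N.veff I - N.veff J) * t := by ring
    have e1 := abs_sub (-(-(x + y) - N.veff I * t) + (-x - N.veff J * t))
      ((N.veff I - N.veff J) * t)
    have e2 := abs_add_le (-(-(x + y) - N.veff I * t)) (-x - N.veff J * t)
    rw [← e] at e1
    rw [abs_neg] at e2
    linarith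
  rw [add_mul] at hy
  rw [mul_assoc]
  rcases le_or_gt (ε / 2 * |t|) |-(x + y) - N.veff I * t| with hoff | hoff
  · refine (hI hoff hcI).trans ?_
    exact mul_le_mul (le_abs_self _) ((hE₁ |t| _ ht hoff eI).trans
      (mul_le_mul_of_nonneg_right (by linarith) hpow))
      (Finset.sum_nonneg fun ν _ => by positivity) (abs_nonneg _)
  · have hoff' : ε / 2 * |t| ≤ |-x - N.veff J * t| := by linarith
    refine (hJ hoff' hcJ).trans ?_
    exact mul_le_mul (le_abs_self _) ((hE₂ |t| _ ht hoff' eJ).trans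
      (mul_le_mul_of_nonneg_right (by linarith) hpow))
      (Finset.sum_nonneg fun ν _ => by positivity) (abs_nonneg _)

/-- Off the two ballistic trajectories, the three-point function decays faster than the inverse
square of the space-time distance. -/
lemma NormalModes.HydroClusters.exists_conn₃_le {a : A} {I J : M} (hh : N.HydroClusters v a I J)
    (hcl : S.Clusters v p) (hv : 0 < v) (hp : 2 < p) {ε : ℝ} (hε : 0 < ε) :
    ∃ η C : ℝ, 2 < η ∧ 0 ≤ C ∧ ∀ t x y : ℝ, (|N.veff I - N.veff J| + ε) * |t| ≤ |y| →
      ‖S.conn₃ (S.evol (N.q I) (x + y) 0) (S.evol (N.q J) x 0) (S.evol a 0 t)‖ ≤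
        C * (1 + |t| + ‖(x + y, x)‖) ^ (-η) := by
  obtain ⟨β, C₀, T, hβ, hC₀, hT, hin⟩ := hh.exists_conn₃_le_of_mem_cone hv hε
  obtain ⟨C₁, hC₁, hloc⟩ := hcl.exists_conn₃_le hv.le (by linarith) (N.q I) (N.q J) a (max T 1)
  obtain ⟨C₂, hC₂⟩ := hcl.three ![N.q I, N.q J, a]
  simp only [Matrix.cons_val_zero, Matrix.cons_val_one, Matrix.cons_val] at hC₂
  set η : ℝ := min β p with hη
  have hη2 : 2 < η := lt_min hβ hp
  have hη0 : 0 ≤ η := by linarith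
  have hηp : η ≤ p := min_le_right _ _
  have hηβ : η ≤ β := min_le_left _ _
  have hμ : 0 < min ε v := lt_min hε hv
  have hexp : ∀ {w e : ℝ}, 1 ≤ w → η ≤ e → w ^ (-e) ≤ w ^ (-η) := fun hw he =>
    Real.rpow_le_rpow_of_exponent_le hw (by linarith)
  -- One constant per regime: bounded time; positions large compared with v |t|; one density outside
  -- the cone of the observable; both inside their cones.
  set K₁ := C₁ * (1 + max T 1) ^ η with hK₁
  set K₂ := |C₂| * (3 + 1 / v) ^ η with hK₂
  set K₃ := |C₂| * ((2 + 3 * v) / min ε v) ^ η with hK₃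
  set K₄ := C₀ * (2 + 3 * v) ^ η with hK₄
  have k1 : 0 ≤ K₁ := by positivity
  have k2 : 0 ≤ K₂ := by positivity
  have k3 : 0 ≤ K₃ := by positivity
  have k4 : 0 ≤ K₄ := by positivity
  refine ⟨η, K₁ + K₂ + K₃ + K₄, hη2, by positivity, fun t x y hy => ?_⟩
  set m : ℝ := ‖(x + y, x)‖ with hm
  have hm0 : 0 ≤ m := norm_nonneg _
  have ht0 : 0 ≤ |t| := abs_nonneg t
  have hu : 0 < 1 + |t| + m := by positivity
  suffices h : ‖S.conn₃ (S.evol (N.q I) (x + y) 0) (S.evol (N.q J) x 0) (S.evol a 0 t)‖ ≤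
      K₁ * (1 + |t| + m) ^ (-η) ∨
      ‖S.conn₃ (S.evol (N.q I) (x + y) 0) (S.evol (N.q J) x 0) (S.evol a 0 t)‖ ≤
      K₂ * (1 + |t| + m) ^ (-η) ∨
      ‖S.conn₃ (S.evol (N.q I) (x + y) 0) (S.evol (N.q J) x 0) (S.evol a 0 t)‖ ≤
      K₃ * (1 + |t| + m) ^ (-η) ∨
      ‖S.conn₃ (S.evol (N.q I) (x + y) 0) (S.evol (N.q J) x 0) (S.evol a 0 t)‖ ≤
      K₄ * (1 + |t| + m) ^ (-η) by
    have hpos := Real.rpow_nonneg hu.le (-η)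
    rcases h with h | h | h | h <;> refine h.trans (mul_le_mul_of_nonneg_right ?_ hpos) <;> linarith
  rcases le_or_gt |t| (max T 1) with htT | htT
  · left
    have h1 := hloc 0 0 t (x + y) x (by simp) (by simp) htT
    refine h1.trans ?_
    rw [hK₁, mul_assoc]
    refine mul_le_mul_of_nonneg_left ((hexp (by linarith) hηp).trans ?_) hC₁
    refine rpow_neg_le_mul_rpow_neg hu (by positivity) hη0 ?_
    have : 0 ≤ max T 1 * m := by positivity
    nlinarith
  right
  have htT' : T ≤ |t| := (le_max_left _ _).trans htT.le
  have ht1 : 1 ≤ |t| := (le_max_right _ _).trans htT.le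
  rcases le_or_gt (v * |t|) (m / 3) with hmt | hmt
  · left
    have h1 := norm_conn₃_le_of_spread hC₂ (r := 0) (s := 0) (t := t) (y := x + y) (z := x)
      (by rw [sub_zero, abs_zero, mul_zero]; positivity) (by rwa [zero_sub, abs_neg])
      (by rwa [zero_sub, abs_neg])
    refine h1.trans ?_
    rw [hK₂, mul_assoc]
    refine mul_le_mul (le_abs_self _) ((hexp (by linarith) hηp).trans ?_) (by positivity)
      (abs_nonneg _)
    refine rpow_neg_le_mul_rpow_neg hu (by positivity) hη0 ?_
    have h2 : |t| ≤ 1 / v * (m / 3) := by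
      rw [one_div, inv_mul_eq_div, le_div_iff₀ hv]
      linarith
    have h3 : 0 < 1 / v := by positivity
    nlinarith
  right
  -- From here on m < 3v|t| and |t| ≥ 1, so powers of |t| control powers of 1 + |t| + m.
  have hut : 1 + |t| + m ≤ (2 + 3 * v) * |t| := by nlinarith
  have hD : 0 ≤ |N.veff I - N.veff J| := abs_nonneg _
  by_cases hcone : v * |t| ≤ |x + y| ∨ v * |t| ≤ |x|
  · left
    have h1 := norm_conn₃_le_of_outside_cone hv hC₂ hε (y := x + y) (z := x) (t := t)
      (by rw [add_sub_cancel_left]; nlinarith) hcone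
    refine h1.trans ?_
    rw [hK₃, mul_assoc]
    refine mul_le_mul (le_abs_self _)
      ((hexp (by linarith [mul_nonneg hμ.le ht0]) hηp).trans ?_) (by positivity) (abs_nonneg _)
    refine rpow_neg_le_mul_rpow_neg hu (by positivity) hη0 (hut.trans ?_)
    rw [div_mul_eq_mul_div, le_div_iff₀ hμ]
    nlinarith
  · right
    push Not at hcone
    have hbound := hin t x y htT' hy hcone.1.le hcone.2.le
    refine hbound.trans ?_
    rw [hK₄, mul_assoc]
    refine mul_le_mul_of_nonneg_left ?_ hC₀
    exact (hexp ht1 hηβ).trans (rpow_neg_le_mul_rpow_neg hu (by positivity) hη0 hut)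

/-- A total power η > 2 suffices for two integrable factors with exponent (η + 2)/4 > 1, and (η -
2)/2 > 0 is left over for decay in time. -/
lemma NormalModes.HydroClusters.exists_conn₃_le_mul {a : A} {I J : M}
    (hh : N.HydroClusters v a I J) (hcl : S.Clusters v p) (hv : 0 < v) (hp : 2 < p) {ε : ℝ}
    (hε : 0 < ε) :
    ∃ C γ r : ℝ, 0 < γ ∧ 1 < r ∧ 0 ≤ C ∧ ∀ t x y : ℝ,
      (|N.veff I - N.veff J| + ε) * |t| ≤ |y| →
      ‖S.conn₃ (S.evol (N.q I) (x + y) 0) (S.evol (N.q J) x 0) (S.evol a 0 t)‖ ≤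
        C * ((1 + |t|) ^ (-γ) * (1 + |y|) ^ (-r) * (1 + |x|) ^ (-r)) := by
  obtain ⟨η, C, hη, hC, h⟩ := hh.exists_conn₃_le hcl hv hp hε
  refine ⟨C * 2 ^ η, (η - 2) / 2, (η + 2) / 4, by linarith, by linarith, by positivity,
    fun t x y hy => (h t x y hy).trans ?_⟩
  rw [mul_assoc]
  refine mul_le_mul_of_nonneg_left ?_ hC
  set L : ℝ := max |t| (max |y| |x|) with hL
  have ht : |t| ≤ L := le_max_left _ _
  have hyL : |y| ≤ L := (le_max_left _ _).trans (le_max_right _ _)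
  have hxL : |x| ≤ L := (le_max_right _ _).trans (le_max_right _ _)
  have hL0 : 0 ≤ L := (abs_nonneg t).trans ht
  have hm1 : |x + y| ≤ ‖(x + y, x)‖ := norm_fst_le (x + y, x)
  have hm2 : |x| ≤ ‖(x + y, x)‖ := norm_snd_le (x + y, x)
  have hy2 : |y| ≤ |x + y| + |x| := by
    have := abs_sub (x + y) x; rwa [add_sub_cancel_left] at this
  have h1 : 1 + L ≤ 2 * (1 + |t| + ‖(x + y, x)‖) := by
    have h0 := abs_nonneg t
    have h0' := abs_nonneg x
    have : L ≤ 2 * |t| + 2 * ‖(x + y, x)‖ :=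
      max_le (by linarith) (max_le (by linarith) (by linarith))
    linarith
  have e0 := rpow_neg_le_mul_rpow_neg (η := η) (by positivity : 0 < 1 + L) two_pos (by linarith) h1
  have e1 := one_add_rpow_neg_add_le (m := L) (abs_nonneg t) hL0 ht le_rfl
    (r := (η - 2) / 2) (s := (η + 2) / 4 + (η + 2) / 4) (by linarith) (by linarith)
  have e2 := one_add_rpow_neg_add_le (m := L) (abs_nonneg y) (abs_nonneg x) hyL hxL
    (r := (η + 2) / 4) (s := (η + 2) / 4) (by linarith) (by linarith)
  rw [show (η - 2) / 2 + ((η + 2) / 4 + (η + 2) / 4) = η by ring] at e1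
  refine e0.trans (mul_le_mul_of_nonneg_left (e1.trans ?_) (by positivity))
  rw [mul_assoc]
  exact mul_le_mul_of_nonneg_left e2 (by positivity)

end ManyBodySystem

namespace ManyBodySystem

/-! ### The lower bound -/

variable {A : Type*} [Ring A] [StarRing A] [Algebra ℂ A] [StarModule ℂ A] {S : ManyBodySystem A}
  {v p : ℝ} {M : Type*} {N : S.NormalModes M}

lemma Clusters.integrable_conn₃_shear (hcl : S.Clusters v p) (hv : 0 ≤ v) (hp : 2 < p)
    (a b c : A) (t : ℝ) : Integrable fun P : ℝ × ℝ =>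
      S.conn₃ (S.evol a (P.2 + P.1) 0) (S.evol b P.2 0) (S.evol c 0 t) := by
  have h := (hcl.integrable_conn₃ hv hp a b c 0 0 t).swap
  exact (measurePreserving_prod_add_swap (volume : Measure ℝ)
    (volume : Measure ℝ)).integrable_comp_of_integrable h

/-- The shear from (y, x) to (x + y, x) preserves Lebesgue measure, so integrating over the
separation and the base point sums over all positions of both charges; conservation then removes t.
-/
lemma Clusters.integral_covForm_quad_time (hcl : S.Clusters v p) (hv : 0 ≤ v) (hp : 2 < p)
    {q j q' j' : A} (h : S.ConservationLaw q j) (h' : S.ConservationLaw q' j')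
    (hq : star q = q) (hq' : star q' = q') (h0 : S.state q = 0) (h0' : S.state q' = 0)
    (a : A) (t : ℝ) :
    Integrable (fun y => S.covForm (S.quad q q' y) (S.time t a)) ∧
      ∫ y, S.covForm (S.quad q q' y) (S.time t a) = S.coupling q q' a := by
  simp only [covForm, covKernel_quad_time hq hq' h0 h0']
  have hi := hcl.integrable_conn₃_shear hv hp q q' a t
  refine ⟨hi.integral_prod_left, ?_⟩
  rw [integral_integral_swap hi, ← hcl.integral_conn₃_eq_coupling hv hp h h' a t,
    Measure.volume_eq_prod ℝ ℝ, integral_prod_symm _ (hcl.integrable_conn₃ hv hp q q' a 0 0 t)]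
  congr 1
  ext x
  exact integral_add_left_eq_self
    (fun y => S.conn₃ (S.evol q y 0) (S.evol q' x 0) (S.evol a 0 t)) x

/-- Truncation error of an integral over the line. -/
lemma norm_intervalIntegral_sub_integral_le {f : ℝ → ℂ} {g : ℝ → ℝ} (hf : Integrable f)
    (hg : Integrable g) (hg0 : ∀ x, 0 ≤ g x) {R : ℝ} (hR : 0 ≤ R)
    (h : ∀ x, R ≤ |x| → ‖f x‖ ≤ g x) :
    ‖(∫ x in (-R)..R, f x) - ∫ x, f x‖ ≤ ∫ x, g x := by
  rw [intervalIntegral.integral_of_le (by linarith),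
    ← integral_add_compl measurableSet_Ioc hf (s := Set.Ioc (-R) R), sub_add_cancel_left, norm_neg]
  refine (norm_integral_le_of_norm_le hg.integrableOn ?_).trans
    (setIntegral_le_integral hg (ae_of_all _ hg0))
  refine (ae_restrict_iff' measurableSet_Ioc.compl).2 (ae_of_all _ fun x hx => h x ?_)
  rw [Set.mem_compl_iff, Set.mem_Ioc, not_and_or, not_lt, not_le] at hx
  rcases hx with hx | hx
  · exact le_trans (by linarith) (neg_le_abs x)
  · exact hx.le.trans (le_abs_self x)

/-- The time-averaged overlap of the observable with the test vector tends to the coupling, if the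
size of the test vector exceeds the distance travelled by the two modes from each other. -/
lemma NormalModes.HydroClusters.tendsto_inner_quadVec {a : A} {I J : M}
    (hh : N.HydroClusters v a I J) (hcl : S.Clusters v p) (hv : 0 < v) (hp : 3 < p) {ε : ℝ}
    (hε : 0 < ε) :
    Tendsto (fun T : ℝ => ((2 * T : ℝ) : ℂ)⁻¹ *
      ⟪S.quadVec (N.q I) (N.q J) ((|N.veff I - N.veff J| + ε) * T),
        ∫ t in (-T)..T, S.cls (S.time t a)⟫_ℂ) atTop (𝓝 (S.coupling (N.q I) (N.q J) a)) := by
  obtain ⟨C, γ, r, hγ, hr, hC, hK⟩ := hh.exists_conn₃_le_mul hcl hv (by linarith) hε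
  have hD : 0 ≤ |N.veff I - N.veff J| := abs_nonneg _
  set V := |N.veff I - N.veff J| + ε with hV
  have hV0 : 0 < V := by positivity
  set c := S.coupling (N.q I) (N.q J) a with hc
  have hi := integrable_one_add_abs_rpow hr
  set κ : ℝ := ∫ x : ℝ, (1 + |x|) ^ (-r) with hκ
  have hcq := hcl.continuous_cls_quad hv.le hp (N.star_q I) (N.star_q J) (N.state_q I)
    (N.state_q J)
  have hct := hcl.continuous_cls_time hv.le (by linarith) a
  have herr : ∀ T t : ℝ, |t| ≤ T →
      ‖⟪S.quadVec (N.q I) (N.q J) (V * T), S.cls (S.time t a)⟫_ℂ - c‖ ≤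
        C * κ * κ * (1 + |t|) ^ (-γ) := by
    intro T t ht
    obtain ⟨h1, h2⟩ := hcl.integral_covForm_quad_time hv.le (by linarith) (N.conservation I)
      (N.conservation J) (N.star_q I) (N.star_q J) (N.state_q I) (N.state_q J) a t
    have hT : 0 ≤ T := (abs_nonneg t).trans ht
    rw [quadVec, inner_intervalIntegral_left hcq, hc, ← h2]
    simp_rw [inner_cls]
    have hκ0 : 0 ≤ κ := integral_nonneg fun x => by positivity
    refine (norm_intervalIntegral_sub_integral_le h1
      (hi.const_mul (C * κ * (1 + |t|) ^ (-γ))) (fun x => by positivity) (by positivity)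
      fun y hy => ?_).trans (le_of_eq ?_)
    -- The window V T exceeds V |t| at every time of the average, so the discarded tail lies
    -- entirely in the decay region.
    · have hy' : V * |t| ≤ |y| := (mul_le_mul_of_nonneg_left ht hV0.le).trans hy
      simp only [covForm, covKernel_quad_time (N.star_q I) (N.star_q J) (N.state_q I)
        (N.state_q J)]
      refine (norm_integral_le_of_norm_le
        (hi.const_mul (C * ((1 + |t|) ^ (-γ) * (1 + |y|) ^ (-r))))
        (ae_of_all _ fun x => (hK t x y hy').trans (le_of_eq (by ring)))).trans (le_of_eq ?_)
      rw [integral_const_mul, ← hκ]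
      ring
    · rw [integral_const_mul, ← hκ]
      ring
  rw [tendsto_iff_norm_sub_tendsto_zero]
  have hz := (tendsto_average_rpow hγ).const_mul (C * κ * κ)
  rw [mul_zero] at hz
  refine squeeze_zero' (Eventually.of_forall fun _ => norm_nonneg _) ?_ hz
  filter_upwards [eventually_gt_atTop 0] with T hT
  have hTc : ((2 * T : ℝ) : ℂ) ≠ 0 := by exact_mod_cast (by positivity : (2 * T : ℝ) ≠ 0)
  set w := S.quadVec (N.q I) (N.q J) (V * T)
  have hcw : Continuous fun t => ⟪w, S.cls (S.time t a)⟫_ℂ := continuous_const.inner hct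
  have e1 : ((2 * T : ℝ) : ℂ)⁻¹ * ⟪w, ∫ t in (-T)..T, S.cls (S.time t a)⟫_ℂ - c =
      ((2 * T : ℝ) : ℂ)⁻¹ * ∫ t in (-T)..T, (⟪w, S.cls (S.time t a)⟫_ℂ - c) := by
    rw [intervalIntegral.integral_sub (hcw.intervalIntegrable _ _) intervalIntegrable_const,
      inner_intervalIntegral_right hct, intervalIntegral.integral_const, Complex.real_smul,
      mul_sub, sub_neg_eq_add, ← two_mul, ← mul_assoc, inv_mul_cancel₀ hTc, one_mul]
  have hcr : Continuous fun t : ℝ => (1 + |t|) ^ (-γ) :=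
    Continuous.rpow_const (by fun_prop) fun s => Or.inl (by positivity)
  rw [e1, norm_mul, norm_inv, Complex.norm_real, Real.norm_of_nonneg (by positivity),
    mul_left_comm]
  refine mul_le_mul_of_nonneg_left ?_ (by positivity)
  rw [← intervalIntegral.integral_const_mul]
  refine intervalIntegral.norm_integral_le_of_norm_le (by linarith) (ae_of_all _ fun t ht => ?_)
    ((hcr.const_mul _).intervalIntegrable _ _)
  exact herr T t (abs_le.2 ⟨ht.1.le, ht.2⟩)

lemma IsBallisticPart.onsagerLower_eq {a a₀ : A} (h : S.IsBallisticPart a a₀) :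
    S.onsagerLower a = liminf (fun T : ℝ => ENNReal.ofReal
      (1 / (2 * T) * ‖∫ t in (-T)..T, S.cls (S.time t (a - a₀))‖ ^ 2)) atTop := by
  rw [onsagerLower, lowerNorm, ← ENNReal.rpow_natCast, ← ENNReal.rpow_mul]
  simp only [h.timeH_sub_projBal]
  norm_num

/-- The Cauchy-Schwarz bound on the Onsager matrix element from a test vector of size
proportional to `T`. -/
lemma NormalModes.HydroClusters.le_onsagerLower {a a₀ : A} {I J : M}
    (hh : N.HydroClusters v (a - a₀) I J) (hcl : S.Clusters v p) (hv : 0 < v) (hp : 3 < p)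
    (ha : S.IsBallisticPart a a₀) {L : ℝ} (hL : 0 < L)
    (hLeq : S.covForm (N.q J) (N.q I) * S.covForm (N.q I) (N.q J) +
      S.covForm (N.q J) (N.q J) * S.covForm (N.q I) (N.q I) = L) {ε : ℝ} (hε : 0 < ε) :
    ENNReal.ofReal (‖S.coupling (N.q I) (N.q J) (a - a₀)‖ ^ 2 /
      (L * (|N.veff I - N.veff J| + ε))) ≤ S.onsagerLower a := by
  have hD : 0 ≤ |N.veff I - N.veff J| := abs_nonneg _
  have hX := (hh.tendsto_inner_quadVec hcl hv hp hε).norm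
  set V := |N.veff I - N.veff J| + ε with hV
  have hV0 : 0 < V := by positivity
  have hY := ((hcl.tendsto_inner_quadVec hv.le hp (N.star_q I) (N.star_q J) (N.state_q I)
    (N.state_q J)).comp (tendsto_id.const_mul_atTop hV0)).norm
  rw [hLeq, Complex.norm_real, Real.norm_of_nonneg hL.le] at hY
  -- The norm of the test vector is normalised by 2VT; the extra factor V restores the normalisation
  -- 2T and yields the limit |c|² / (L V).
  have hlim := ENNReal.tendsto_ofReal ((hX.pow 2).div (hY.mul_const V) (by positivity))
  rw [ha.onsagerLower_eq, ← hlim.liminf_eq]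
  refine liminf_le_liminf ?_
  filter_upwards [eventually_gt_atTop 0] with T hT
  refine ENNReal.ofReal_le_ofReal ?_
  simp only [Pi.div_apply, Function.comp_apply, id_eq, norm_mul, norm_inv, Complex.norm_real]
  set w := S.quadVec (N.q I) (N.q J) (V * T)
  set Φ := ∫ t in (-T)..T, S.cls (S.time t (a - a₀))
  have hw : ‖⟪w, w⟫_ℂ‖ = ‖w‖ ^ 2 := by rw [inner_self_eq_norm_sq_to_K]; simp
  have hCS : ‖⟪w, Φ⟫_ℂ‖ ≤ ‖w‖ * ‖Φ‖ := norm_inner_le_norm w Φ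
  rw [hw]
  simp only [Real.norm_ofNat, Real.norm_of_nonneg hT.le, Real.norm_of_nonneg hV0.le]
  -- This form needs only a nonnegative denominator, so the test vector may vanish at a given T.
  refine div_le_of_le_mul₀ (by positivity) (by positivity) ?_
  calc ((2 * T)⁻¹ * ‖⟪w, Φ⟫_ℂ‖) ^ 2 ≤ ((2 * T)⁻¹ * (‖w‖ * ‖Φ‖)) ^ 2 := by gcongr
    _ = _ := by field_simp

end ManyBodySystem

/-! ### The theorem: choice of ε -/

theorem mainTheorem2 {A : Type*} [Ring A] [StarRing A] [Algebra ℂ A] [StarModule ℂ A]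
    (S : ManyBodySystem A) {M : Type*} (N : S.NormalModes M)
    (v p : ℝ) (hv : 0 < v) (hp : 3 < p) (hcl : S.Clusters v p) :
    (∀ (a a₀ : A) (I J : M), S.IsBallisticPart a a₀ → N.HydroClusters v (a - a₀) I J →
      (N.veff I ≠ N.veff J →
        ENNReal.ofReal (‖S.coupling (N.q I) (N.q J) (a - a₀)‖ ^ 2 / |N.veff I - N.veff J|)
          ≤ S.onsagerLower a) ∧
      (N.veff I = N.veff J → S.coupling (N.q I) (N.q J) (a - a₀) ≠ 0 →
        S.onsagerLower a = ⊤)) ∧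
    (∀ (q j j₀ : A) (I : M), S.ConservationLaw q j → S.IsBallisticPart j j₀ →
      N.HydroClusters v (j - j₀) I I →
      S.coupling (N.q I) (N.q I) (j - j₀) ≠ 0 → S.onsagerLower j = ⊤) := by
  have hself : ∀ I, S.covForm (N.q I) (N.q I) = 1 := fun I => by
    rw [← S.inner_cls, inner_self_eq_norm_sq_to_K, N.orthonormal.1 I]
    simp
  have hne : ∀ I J, I ≠ J → S.covForm (N.q I) (N.q J) = 0 := fun I J hIJ => by
    rw [← S.inner_cls]
    exact N.orthonormal.2 hIJ
  have htop : ∀ (a a₀ : A) (I J : M), S.IsBallisticPart a a₀ →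
      N.HydroClusters v (a - a₀) I J → N.veff I = N.veff J →
      S.coupling (N.q I) (N.q J) (a - a₀) ≠ 0 → S.onsagerLower a = ⊤ := by
    intro a a₀ I J ha hh hIJ hc
    -- Both Wick pairings contribute when I = J; orthogonality removes the crossed one otherwise.
    obtain ⟨L, hL, hLeq⟩ : ∃ L : ℝ, 0 < L ∧ S.covForm (N.q J) (N.q I) * S.covForm (N.q I) (N.q J) +
        S.covForm (N.q J) (N.q J) * S.covForm (N.q I) (N.q I) = L := by
      by_cases h : I = J
      · exact ⟨2, two_pos, by rw [h, hself]; norm_num⟩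
      · exact ⟨1, one_pos, by rw [hne I J h, hself, hself]; norm_num⟩
    refine ENNReal.eq_top_of_forall_nnreal_le fun r => ?_
    have hn : 0 < ‖S.coupling (N.q I) (N.q J) (a - a₀)‖ := norm_pos_iff.2 hc
    have hr : (0 : ℝ) < r + 1 := by positivity
    -- With equal velocities V = ε, and this ε makes the lower bound equal to r + 1.
    have h := hh.le_onsagerLower hcl hv hp ha hL hLeq
      (ε := ‖S.coupling (N.q I) (N.q J) (a - a₀)‖ ^ 2 / (L * (r + 1))) (by positivity)
    refine le_trans ?_ h
    rw [hIJ, sub_self, abs_zero, zero_add, ← ENNReal.ofReal_coe_nnreal]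
    refine ENNReal.ofReal_le_ofReal ?_
    rw [le_div_iff₀ (by positivity)]
    have e : L * (‖S.coupling (N.q I) (N.q J) (a - a₀)‖ ^ 2 / (L * (r + 1))) =
        ‖S.coupling (N.q I) (N.q J) (a - a₀)‖ ^ 2 / (r + 1) := by field_simp
    rw [e, mul_div_assoc', div_le_iff₀ hr]
    nlinarith [sq_nonneg ‖S.coupling (N.q I) (N.q J) (a - a₀)‖]
  refine ⟨fun a a₀ I J ha hh => ⟨fun hIJ => ?_, htop a a₀ I J ha hh⟩,
    fun _ j j₀ I _ hj hh hc => htop j j₀ I I hj hh rfl hc⟩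
  -- Distinct velocities force distinct modes, so L = 1 and the bound passes to the limit ε → 0.
  have hIJ' : I ≠ J := fun h => hIJ (by rw [h])
  have hD : |N.veff I - N.veff J| ≠ 0 := abs_ne_zero.2 (sub_ne_zero.2 hIJ)
  have hlim : Tendsto (fun ε : ℝ => ENNReal.ofReal
      (‖S.coupling (N.q I) (N.q J) (a - a₀)‖ ^ 2 / (1 * (|N.veff I - N.veff J| + ε))))
      (𝓝[>] 0) (𝓝 (ENNReal.ofReal
        (‖S.coupling (N.q I) (N.q J) (a - a₀)‖ ^ 2 / |N.veff I - N.veff J|))) := by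
    refine ENNReal.tendsto_ofReal (tendsto_const_nhds.div ?_ hD)
    have : Continuous fun ε : ℝ => 1 * (|N.veff I - N.veff J| + ε) := by fun_prop
    have h0 := this.tendsto 0
    rw [add_zero, one_mul] at h0
    exact h0.mono_left nhdsWithin_le_nhds
  refine le_of_tendsto hlim ?_
  filter_upwards [self_mem_nhdsWithin] with ε hε
  exact hh.le_onsagerLower hcl hv hp ha one_pos
    (by rw [hne I J hIJ', hself, hself]; norm_num) hε
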